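/- **Setting.** Let $G=(V,E)$ be a finite undirected simple graph and $I$ a finite set of agents. Agent $i$ needs time $\tau^i(u,v)>0$ to move from $u$ to an adjacent vertex $v$; it has a start $v_s^i$ and a goal $v_g^i$, where distinct agents have distinct starts and distinct goals. A path of $i$ begins at $v_s^i$ at time $0$. At each vertex the agent performs a wait of some duration $\ge 0$ and then a move, and after its last arrival, at $v_g^i$, it waits there forever. An action $((v_1,t_1),(v_2,t_2))$ (a move, or a wait with $v_1=v_2$ and possibly $t_2=\infty$) occupies $v_1$ at time $t_1$, $v_2$ at time $t_2$ (if $t_2<\infty$), and both vertices during $(t_1,t_2)$. A joint path is conflict-free if no vertex is occupied by two agents at the same time. The cost of a path is its last arrival time ($0$ if there is no move). A solution is a conflict-free joint path, and it is optimal if its sum of costs is minimum among all solutions. **Constraints on an agent $i$.** A motion constraint $\langle i,u\to v,[l,r)\rangle$ forbids the moves from $u$ to $v$ that start at a time in $[l,r)$ ($u$ or $v$ may be $*$, meaning any vertex). A wait constraint $\langle i,v,[l,r)\rangle_W$ forbids the waits at $v$, of duration zero too, whose time interval meets $[l,r)$. An occupancy constraint $\langle i,v,t\rangle_O$ forbids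 the actions that occupy $v$ at time $t$. **CBS-AA.** The high-level search keeps a list OPEN of nodes, each a joint path with a set of constraints. Initially OPEN contains one node, with no constraints and with an individually optimal path for each agent. While OPEN is non-empty, a node with minimum sum of costs is removed from OPEN. If its joint path is conflict-free, this joint path is returned. Otherwise an earliest conflict between some two agents $i,j$ is chosen, at a vertex $v$, in which $i$ performs a move $((u,t_1^i),(v,t_2^i))$ into $v$, and $j$ performs an action from time $t_1^j$ to $t_2^j$ which is a move $w\to v$ (IN-IN), a move $v\to w$ (OUT-IN), or a wait at $v$ (WAIT-IN). Two new nodes are formed. In one, agent $i$ receives the constraints generated for $i$ in addition to those of the removed node and is replanned; in the other, the same is done for $j$. A new node is discarded if the planner finds no path, and is added to OPEN otherwise. If OPEN is empty, failure is reported. The low-level planner is safe interval path planning. The safe intervals of a vertex are the maximal time intervals during which waiting there is allowed by the constraints. From an arrival time at a vertex, a move is generated, for each safe interval of its target, with the earliest allowed departure for which the arrival lies in that safe interval. Additionally, departures may be generated that are earliest among those not before a time at which another agent completes a move out of the target (end of a soft constraint). The goal is accepted if the agent may stay there forever, and a generated path of minimum cost is returned. The constraints are generated by one of the following two methods. Put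 $\tau_{in}^k(x)=\min_{(y,x)\in E}\tau^k(y,x)$ and $\tau_{out}^k(x)=\min_{(x,y)\in E}\tau^k(x,y)$; where the argument is omitted, it is $v$. * *Constraints on single actions.* IN-IN and OUT-IN: motion constraints on the move of $i$ with $[t_1^i,t_2^j)$, and on the move of $j$ with $[t_1^j,t_2^i)$. WAIT-IN: $\langle i,v,t_r\rangle_O$ and $\langle j,v,t_r\rangle_O$, where $t_r=\min(t_2^i,t_2^j)$. * *Constraints on multiple actions.* Let $e=t_1^i+\tau_{in}^i+\tau_{out}^i$. * IN-IN: $\langle i,*\to v,[t_1^i,\,t_1^j+\tau_{in}^j+\tau_{out}^j)\rangle$ and $\langle j,*\to v,[t_1^j,\,e)\rangle$. * OUT-IN: $\langle i,*\to v,[t_1^i,\,t_1^j+\tau_{out}^j)\rangle$ for $i$; both $\langle j,v,[t_1^j,\,e+\tau_{in}^j)\rangle_W$ and $\langle j,v\to *,[t_1^j,\,e+\tau_{in}^j)\rangle$ for $j$. * WAIT-IN, $t_2^j<e+\tau_{in}^j$: $\langle i,*\to v,[t_1^i,\,t_2^j+\tau_{out}^j)\rangle$ and $\langle j,v,[t_2^j,\,e+\tau_{in}^j)\rangle_W$.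 * WAIT-IN, $t_2^j\ge e+\tau_{in}^j$: $\langle i,*\to v,[t_1^i,\,e+\tau_{out}^j)\rangle$ and $\langle j,v,[e,\,e+\tau_{in}^j)\rangle_W$. **Theorem.** Let CBS-AA be run with constraints on single actions, or with constraints on multiple actions provided that each agent has the same travel time on all edges (which may differ between agents). Then, for every way of breaking ties (among nodes of minimum sum of costs, among the pairs in conflict and their earliest conflicts, and among the paths that the planner may return): 1. (Optimality) every joint path that the search returns is an optimal solution; 2. (Solution completeness) if a solution exists, then the root node exists, every run of the high-level search stops after finitely many iterations, and it stops only by returning an optimal solution (it neither gets stuck nor reports failure). -/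

import Mathlib

/-- An instance of multi-agent path finding with asynchronous actions: an undirected graph, a positive
travel time for every agent and every directed traversal of an edge, pairwise distinct start vertices
and pairwise distinct goal vertices (no conflict when all agents stay at their starts, and none when
all of them stay at their goals). -/
structure MAPFAA (I V : Type*) where
  G : SimpleGraph V
  τ : I → V → V → ℝ
  τ_pos : ∀ i u v, G.Adj u v → 0 < τ i u v
  start : I → V
  goal : I → V
  start_injective : Function.Injective start
  goal_injective : Function.Injective goal

namespace MAPFAA

/-- A timed action. `move u w t₁ t₂` is the transition `((u, t₁), (w, t₂))`, and `wait v t₁ t₂` is the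
transition `((v, t₁), (v, t₂))`, where `t₂ = ⊤` means waiting forever. -/
inductive Action (V : Type*)
  | move (u w : V) (t₁ t₂ : ℝ)
  | wait (v : V) (t₁ : ℝ) (t₂ : WithTop ℝ)

namespace Action

variable {V : Type*}

/-- The vertex at which the action begins. -/
def src : Action V → V
  | move u _ _ _ => u
  | wait v _ _ => v

/-- The vertex at which the action ends. -/
def tgt : Action V → V
  | move _ w _ _ => w
  | wait v _ _ => v

/-- The time at which the action begins. -/
def startTime : Action V → ℝ
  | move _ _ t₁ _ => t₁
  | wait _ t₁ _ => t₁

/-- The time at which the action ends. -/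
def endTime : Action V → WithTop ℝ
  | move _ _ _ t₂ => (t₂ : WithTop ℝ)
  | wait _ _ t₂ => t₂

/-- Duration occupancy: the times at which the action occupies the vertex `v`. The first vertex is
occupied at the beginning, the last one at the end, and both at all times strictly in between. -/
def occ (A : Action V) (v : V) : Set ℝ :=
  {t | (v = A.src ∧ t = A.startTime) ∨ (v = A.tgt ∧ (t : WithTop ℝ) = A.endTime) ∨
    ((v = A.src ∨ v = A.tgt) ∧ A.startTime < t ∧ (t : WithTop ℝ) < A.endTime)}

end Action

/-- A plan of one agent: the list of its moves, each given by its departure time and its target. At every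
vertex the agent waits, possibly for duration zero, from its arrival until its next departure, and it
waits forever after its last arrival. -/
abbrev Plan (V : Type*) := List (ℝ × V)

/-- A plan for every agent. -/
abbrev JointPlan (I V : Type*) := I → Plan V

/-- Constraints on a single agent: motion constraints on `[l, r)` (the value `none` is the wildcard `*`),
wait constraints on `[l, r)`, and occupancy constraints at a time point. -/
inductive Constraint (V : Type*)
  | motion (src tgt : Option V) (l r : ℝ)
  | wait (v : V) (l r : ℝ)
  | occupancy (v : V) (t : ℝ)

/-- The constraint forbids the action. -/
def Constraint.Forbids {V : Type*} : Constraint V → Action V → Prop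
  | .motion s e l r, .move u w t₁ _ => (∀ x ∈ s, x = u) ∧ (∀ x ∈ e, x = w) ∧ l ≤ t₁ ∧ t₁ < r
  | .motion _ _ _ _, .wait _ _ _ => False
  | .wait _ _ _, .move _ _ _ _ => False
  | .wait v l r, .wait x t₁ t₂ => x = v ∧ ((Action.wait x t₁ t₂).occ v ∩ Set.Ico l r).Nonempty
  | .occupancy v t, A => t ∈ A.occ v

/-- The action is forbidden by no constraint of the set. -/
def Allowed {V : Type*} (C : Set (Constraint V)) (A : Action V) : Prop :=
  ∀ c ∈ C, ¬ c.Forbids A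

/-- The three types of conflicts at the vertex `v`, with the two actions involved: agent `i` performs
the move `((u, a), (v, a'))` into `v`, and agent `j` performs the move `((w, b), (v, b'))` into `v`
(`inIn`), the move `((v, b), (w, b'))` out of `v` (`outIn`), or a wait from `b` to `b'` at `v`
(`waitIn`). -/
inductive Conflict (I V : Type*)
  | inIn (i j : I) (v u w : V) (a a' b b' : ℝ)
  | outIn (i j : I) (v u w : V) (a a' b b' : ℝ)
  | waitIn (i j : I) (v u : V) (a a' b : ℝ) (b' : WithTop ℝ)

namespace Conflict

variable {I V : Type*}

/-- The agent that performs the move into the vertex. -/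
def agentI : Conflict I V → I
  | inIn i _ _ _ _ _ _ _ _ => i
  | outIn i _ _ _ _ _ _ _ _ => i
  | waitIn i _ _ _ _ _ _ _ => i

/-- The other agent. -/
def agentJ : Conflict I V → I
  | inIn _ j _ _ _ _ _ _ _ => j
  | outIn _ j _ _ _ _ _ _ _ => j
  | waitIn _ j _ _ _ _ _ _ => j

/-- The action of the agent that moves into the vertex. -/
def actI : Conflict I V → Action V
  | inIn _ _ v u _ a a' _ _ => .move u v a a'
  | outIn _ _ v u _ a a' _ _ => .move u v a a'
  | waitIn _ _ v u a a' _ _ => .move u v a a'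

/-- The action of the other agent. -/
def actJ : Conflict I V → Action V
  | inIn _ _ v _ w _ _ b b' => .move w v b b'
  | outIn _ _ v _ w _ _ b b' => .move v w b b'
  | waitIn _ _ v _ _ _ b b' => .wait v b b'

/-- The vertex at which the conflict takes place. -/
def vertex : Conflict I V → V
  | inIn _ _ v _ _ _ _ _ _ => v
  | outIn _ _ v _ _ _ _ _ _ => v
  | waitIn _ _ v _ _ _ _ _ => v

/-- The times at which both actions occupy the vertex of the conflict. -/
def overlap (c : Conflict I V) : Set ℝ :=
  c.actI.occ c.vertex ∩ c.actJ.occ c.vertex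

end Conflict

/-- The two ways of generating constraints: on single actions and on multiple actions. -/
inductive Method
  | single
  | multi

/-- A node of the high-level search tree: a joint plan and a set of constraints, each tagged with the
agent to which it applies. -/
structure Node (I V : Type*) where
  plan : JointPlan I V
  constraints : Set (I × Constraint V)

/-- The constraints of a tagged set that apply to agent `i`. -/
def constraintsOf {I V : Type*} (Ω : Set (I × Constraint V)) (i : I) : Set (Constraint V) :=
  {c | (i, c) ∈ Ω}

/-- A state of the high-level search: the loop is running with a given OPEN list, or the search has
returned a joint plan, or it has reported failure. -/
inductive SearchState (I V : Type*)
  | running (OPEN : Multiset (Node I V))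
  | returned (π : JointPlan I V)
  | failure

variable {I V : Type*} (P : MAPFAA I V)

/-- For each agent, all edges have the same travel time. -/
def EqualTravelTimes : Prop :=
  ∀ i, ∃ c : ℝ, ∀ u v, P.G.Adj u v → P.τ i u v = c

/-! ## Paths, conflicts and solutions -/

/-- The moves of the list can be executed by agent `i` from the vertex `v`, reached at time `t`, and
lead to its goal. -/
def IsPathFrom (i : I) : V → ℝ → Plan V → Prop
  | v, _, [] => v = P.goal i
  | v, t, (d, w) :: l => t ≤ d ∧ P.G.Adj v w ∧ IsPathFrom i w (d + P.τ i v w) l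

/-- The time of the last arrival when agent `i` executes the list from the vertex `v`, reached at time
`t`. -/
def arrivalFrom (i : I) : V → ℝ → Plan V → ℝ
  | _, t, [] => t
  | v, _, (d, w) :: l => arrivalFrom i w (d + P.τ i v w) l

/-- The sequence of wait and move actions that agent `i` performs when it executes the list from the
vertex `v`, reached at time `t`. The last action is to wait forever. -/
def actionsFrom (i : I) : V → ℝ → Plan V → List (Action V)
  | v, t, [] => [.wait v t ⊤]
  | v, t, (d, w) :: l =>
      .wait v t (d : WithTop ℝ) :: .move v w d (d + P.τ i v w) ::
        actionsFrom i w (d + P.τ i v w) l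

/-- The plan is a path of agent `i` from its start, at time `0`, to its goal. -/
def IsPath (i : I) (p : Plan V) : Prop := P.IsPathFrom i (P.start i) 0 p

/-- The cost of a path: the time at which the goal is reached in order to stay there forever. -/
def cost (i : I) (p : Plan V) : ℝ := P.arrivalFrom i (P.start i) 0 p

/-- The actions that agent `i` performs when it executes the plan. -/
def actions (i : I) (p : Plan V) : List (Action V) := P.actionsFrom i (P.start i) 0 p

/-- Agent `i`, executing `p`, occupies the vertex `v` at time `t`. -/
def Occupies (i : I) (p : Plan V) (v : V) (t : ℝ) : Prop :=
  ∃ A ∈ P.actions i p, t ∈ A.occ v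

/-- At any time, every vertex is occupied by at most one agent. -/
def ConflictFree (π : JointPlan I V) : Prop :=
  ∀ i j, i ≠ j → ∀ v t, ¬ (P.Occupies i (π i) v t ∧ P.Occupies j (π j) v t)

/-- A solution: a conflict-free joint path that leads every agent from its start to its goal. -/
def IsSolution (π : JointPlan I V) : Prop :=
  (∀ i, P.IsPath i (π i)) ∧ P.ConflictFree π

/-- The sum of costs of a joint plan. -/
def sumOfCosts [Fintype I] (π : JointPlan I V) : ℝ := ∑ i, P.cost i (π i)

/-- A solution of minimum sum of costs. -/
def IsOptimal [Fintype I] (π : JointPlan I V) : Prop :=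
  P.IsSolution π ∧ ∀ σ, P.IsSolution σ → P.sumOfCosts π ≤ P.sumOfCosts σ

/-- `c` is an earliest conflict between its two agents in the joint plan `π`. -/
def IsEarliestConflict (π : JointPlan I V) (c : Conflict I V) : Prop :=
  c.agentI ≠ c.agentJ ∧
  c.actI ∈ P.actions c.agentI (π c.agentI) ∧ c.actJ ∈ P.actions c.agentJ (π c.agentJ) ∧
  c.overlap.Nonempty ∧
  ∀ v t, P.Occupies c.agentI (π c.agentI) v t → P.Occupies c.agentJ (π c.agentJ) v t →
    sInf c.overlap ≤ t

/-! ## The low-level planner: safe interval path planning -/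

/-- Agent `i`, having reached `v` at time `t`, may wait there until `d` and then move to `w`, arriving
at a time at which it may be at rest at `w`. -/
def Feasible (i : I) (C : Set (Constraint V)) (v : V) (t : ℝ) (w : V) (d : ℝ) : Prop :=
  t ≤ d ∧ Allowed C (.wait v t (d : WithTop ℝ)) ∧ Allowed C (.move v w d (d + P.τ i v w)) ∧
    Allowed C (.wait w (d + P.τ i v w) ((d + P.τ i v w : ℝ) : WithTop ℝ))

/-- Among the feasible departures at or after `b`, there is none before `d` whose arrival at `w` lies in
the same safe interval of `w` as the arrival for `d` (two arrival times lie in the same safe interval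
when waiting from the first to the second is allowed). -/
def EarliestDeparture (i : I) (C : Set (Constraint V)) (b : ℝ) (v : V) (t : ℝ) (w : V) (d : ℝ) :
    Prop :=
  P.Feasible i C v t w d ∧ b ≤ d ∧
    ∀ d', P.Feasible i C v t w d' → b ≤ d' → d' < d →
      ¬ Allowed C (.wait w (d' + P.τ i v w) ((d + P.τ i v w : ℝ) : WithTop ℝ))

/-- The continuations that the planner of agent `i` generates from the state `(v, t)`: each move departs
as early as possible for the safe interval of its target, counting either from the arrival at the
current vertex, or from a time in `soft w`, at which a soft constraint on the target `w` ends; the goal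
is accepted when the agent may stay there forever. -/
def GeneratedFrom (i : I) (C : Set (Constraint V)) (soft : V → Set ℝ) : V → ℝ → Plan V → Prop
  | v, t, [] => v = P.goal i ∧ Allowed C (.wait v t ⊤)
  | v, t, (d, w) :: l =>
      P.G.Adj v w ∧ (∃ b, (b = t ∨ b ∈ soft w) ∧ P.EarliestDeparture i C b v t w d) ∧
        GeneratedFrom i C soft w (d + P.τ i v w) l

/-- The paths that the planner of agent `i` generates. -/
def Generated (i : I) (C : Set (Constraint V)) (soft : V → Set ℝ) (p : Plan V) : Prop :=
  P.GeneratedFrom i C soft (P.start i) 0 p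

/-- `p` is a possible output of the planner: a generated path of minimum cost. -/
def LowLevelPlan (i : I) (C : Set (Constraint V)) (soft : V → Set ℝ) (p : Plan V) : Prop :=
  P.Generated i C soft p ∧ ∀ q, P.Generated i C soft q → P.cost i p ≤ P.cost i q

/-- The soft constraints from the plans of the other agents: the times at which an agent other than `i`
completes a move out of `w`. -/
def softEnds (π : JointPlan I V) (i : I) (w : V) : Set ℝ :=
  {b | ∃ j, j ≠ i ∧ ∃ x a, Action.move w x a b ∈ P.actions j (π j)}

/-! ## Generation of constraints -/

/-- The minimum travel time of agent `i` into `v`. -/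
noncomputable def τin (i : I) (v : V) : ℝ := ⨅ u : {u // P.G.Adj u v}, P.τ i u v

/-- The minimum travel time of agent `i` out of `v`. -/
noncomputable def τout (i : I) (v : V) : ℝ := ⨅ u : {u // P.G.Adj v u}, P.τ i v u

/-- Constraints on single actions: the constraints for agent `i` and those for agent `j`. In the third
case the time point is the earlier one of the end times of the two actions. -/
noncomputable def singleConstraints : Conflict I V → Set (Constraint V) × Set (Constraint V)
  | .inIn _ _ v u w a a' b b' =>
      ({.motion (some u) (some v) a b'}, {.motion (some w) (some v) b a'})
  | .outIn _ _ v u w a a' b b' =>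
      ({.motion (some u) (some v) a b'}, {.motion (some v) (some w) b a'})
  | .waitIn _ _ v _ _ a' _ b' =>
      ({.occupancy v (min a' (b'.untopD a'))}, {.occupancy v (min a' (b'.untopD a'))})

open Classical in
/-- Constraints on multiple actions: the constraints for agent `i` and those for agent `j`. In the third
case a short wait (which is in particular finite) and a long wait are treated differently. -/
noncomputable def multiConstraints : Conflict I V → Set (Constraint V) × Set (Constraint V)
  | .inIn i j v _ _ a _ b _ =>
      ({.motion none (some v) a (b + P.τin j v + P.τout j v)},
       {.motion none (some v) b (a + P.τin i v + P.τout i v)})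
  | .outIn i j v _ _ a _ b _ =>
      ({.motion none (some v) a (b + P.τout j v)},
       {.wait v b (a + P.τin i v + P.τout i v + P.τin j v),
        .motion (some v) none b (a + P.τin i v + P.τout i v + P.τin j v)})
  | .waitIn i j v _ a _ _ b' =>
      if b' < ((a + P.τin i v + P.τout i v + P.τin j v : ℝ) : WithTop ℝ) then
        ({.motion none (some v) a (b'.untopD 0 + P.τout j v)},
         {.wait v (b'.untopD 0) (a + P.τin i v + P.τout i v + P.τin j v)})
      else
        ({.motion none (some v) a (a + P.τin i v + P.τout i v + P.τout j v)},
         {.wait v (a + P.τin i v + P.τout i v) (a + P.τin i v + P.τout i v + P.τin j v)})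

/-- The two constraint sets with which a conflict is resolved. -/
noncomputable def generateConstraints :
    Method → Conflict I V → Set (Constraint V) × Set (Constraint V)
  | .single, c => singleConstraints c
  | .multi, c => P.multiConstraints c

/-! ## The high-level search -/

/-- The node obtained from `N` by imposing the new constraints `ω` on agent `k` and replanning this
agent, as a multiset with one element, or the empty multiset if the planner fails. -/
inductive Child (N : Node I V) (k : I) (ω : Set (Constraint V)) : Multiset (Node I V) → Prop
  | planned (N' : Node I V)
      (hc : N'.constraints = N.constraints ∪ {x | x.1 = k ∧ x.2 ∈ ω})
      (hother : ∀ j, j ≠ k → N'.plan j = N.plan j)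
      (hplan : P.LowLevelPlan k (constraintsOf N'.constraints k) (P.softEnds N.plan k)
        (N'.plan k)) :
      Child N k ω {N'}
  | infeasible
      (hnone : ∀ p, ¬ P.Generated k
        (constraintsOf (N.constraints ∪ {x | x.1 = k ∧ x.2 ∈ ω}) k) (P.softEnds N.plan k) p) :
      Child N k ω 0

/-- The search begins with OPEN consisting of one root node, without constraints, in which every agent
has an individually optimal path. -/
def Initial (s : SearchState I V) : Prop :=
  ∃ π : JointPlan I V, (∀ i, P.LowLevelPlan i ∅ (fun _ => ∅) (π i)) ∧ s = .running {⟨π, ∅⟩}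

/-- One iteration of the high-level loop. All ties (which node of minimum sum of costs to pop, which
earliest conflict to resolve, which minimum-cost path to plan) may be broken arbitrarily. -/
inductive Step [Fintype I] (m : Method) : SearchState I V → SearchState I V → Prop
  | finish (N : Node I V) (R : Multiset (Node I V))
      (hmin : ∀ M ∈ R, P.sumOfCosts N.plan ≤ P.sumOfCosts M.plan)
      (hfree : P.ConflictFree N.plan) :
      Step m (.running (N ::ₘ R)) (.returned N.plan)
  | expand (N : Node I V) (R : Multiset (Node I V))
      (hmin : ∀ M ∈ R, P.sumOfCosts N.plan ≤ P.sumOfCosts M.plan)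
      (c : Conflict I V) (hc : P.IsEarliestConflict N.plan c)
      (S T : Multiset (Node I V))
      (hS : P.Child N c.agentI (P.generateConstraints m c).1 S)
      (hT : P.Child N c.agentJ (P.generateConstraints m c).2 T) :
      Step m (.running (N ::ₘ R)) (.running (R + S + T))
  | fail : Step m (.running 0) .failure

/-- `s` is reachable from `s₀` by finitely many iterations. -/
def Reaches [Fintype I] (m : Method) (s₀ s : SearchState I V) : Prop :=
  Relation.ReflTransGen (P.Step m) s₀ s

/-- Every run of the search from `s₀` is finite. -/
def Terminates [Fintype I] (m : Method) (s₀ : SearchState I V) : Prop :=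
  ¬ ∃ run : ℕ → SearchState I V, run 0 = s₀ ∧ ∀ n, P.Step m (run n) (run (n + 1))

end MAPFAA

namespace MAPFAA

variable {I V : Type*}

/-! ## Occupancy -/

/-! The search is a best-first branching over the set of solutions, and three facts carry it.

Discreteness. Let `M` be the additive monoid generated by the travel times. With finitely many
agents and vertices, `M` has finitely many elements below any bound (`finite_timeMonoid_le`). The
generated constraints stop forbidding departures only at times of `M`
(`generateConstraints_endsInTimeMonoid`), so a feasible departure can be rounded down to `M` within
its safe interval (`Feasible.push_down`). Hence the planner departs only at times of `M`, the minima
it needs exist, and it generates a path at most as costly as any given path that obeys the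
constraints (`exists_generated_le`).

Branching loses no solution. In a solution the two agents cannot both violate their new constraints
(`generateConstraints_disjoint`). For single actions, two such violations put both agents at the
vertex at a common time. For multiple actions, an agent with equal travel times `c` that rests at a
vertex at time `z` occupies it at all nonnegative times of `(z - c, z + c)`, and the windows force
two such intervals to overlap. So every solution obeys the constraints of some node in OPEN, whose
cost is a lower bound for it; a conflict-free node of minimum cost is therefore optimal.

Progress. A joint path with conflicts has an earliest conflict (`exists_isEarliestConflict`), and
both agents violate their new constraints (`IsEarliestConflict.exists_forbidden`), so each child
gains a constraint set that its parent lacked. If a solution of cost `B` exists, removed nodes cost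
at most `B`, and by discreteness their conflicts come from a finite set. Weighting a node by `3` to
the number of resolutions not yet applied makes the total weight of OPEN decrease strictly. -/

theorem Action.mem_occ_wait {v x : V} {a t : ℝ} {b : WithTop ℝ} (h : (a : WithTop ℝ) ≤ b) :
    t ∈ (Action.wait v a b).occ x ↔ x = v ∧ a ≤ t ∧ (t : WithTop ℝ) ≤ b := by
  induction b using WithTop.recTopCoe with
  | top =>
    simp only [occ, src, tgt, startTime, endTime, Set.mem_ofPred_eq, WithTop.coe_ne_top, and_false,
      false_or, WithTop.coe_lt_top, and_true, le_top, or_self]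
    grind
  | coe b =>
    simp only [occ, src, tgt, startTime, endTime, Set.mem_ofPred_eq, WithTop.coe_inj,
      WithTop.coe_lt_coe, WithTop.coe_le_coe] at h ⊢
    grind

/-- The half-open ends matter: the target is still free at the departure, so a move departing
exactly at the time of an occupancy constraint on its target does not violate it. -/
theorem Action.mem_occ_move {u w x : V} {d e t : ℝ} (h : d < e) :
    t ∈ (Action.move u w d e).occ x ↔ (x = u ∧ d ≤ t ∧ t < e) ∨ (x = w ∧ d < t ∧ t ≤ e) := by
  simp only [occ, src, tgt, startTime, endTime, Set.mem_ofPred_eq, WithTop.coe_inj,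
      WithTop.coe_lt_coe]
  grind

/-! ### Allowed waits under restriction and concatenation -/

theorem Allowed.mono_wait {C : Set (Constraint V)} {v : V} {a a' : ℝ} {b b' : WithTop ℝ}
    (h : Allowed C (.wait v a b)) (ha : a ≤ a') (hab : (a' : WithTop ℝ) ≤ b') (hb : b' ≤ b) :
    Allowed C (.wait v a' b') := by
  have hab' : (a : WithTop ℝ) ≤ b := (WithTop.coe_le_coe.2 ha).trans (hab.trans hb)
  have key : ∀ x, (Action.wait v a' b').occ x ⊆ (Action.wait v a b).occ x := by
    intro x t ht
    rw [Action.mem_occ_wait hab] at ht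
    rw [Action.mem_occ_wait hab']
    exact ⟨ht.1, ha.trans ht.2.1, ht.2.2.trans hb⟩
  intro c hc hf
  refine h c hc ?_
  match c, hf with
  | .wait x l r, hf => exact ⟨hf.1, hf.2.mono (Set.inter_subset_inter_left _ (key _))⟩
  | .occupancy x t, hf => exact key _ hf

/-- A forbidden time in the union lies in one of the two closed intervals, and motion constraints
never forbid waits. This is the transitivity of lying in the same safe interval. -/
theorem Allowed.wait_trans {C : Set (Constraint V)} {v : V} {a b : ℝ} {c : WithTop ℝ}
    (h₁ : Allowed C (.wait v a b)) (h₂ : Allowed C (.wait v b c)) (hab : a ≤ b)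
    (hbc : (b : WithTop ℝ) ≤ c) : Allowed C (.wait v a c) := by
  have hab' : (a : WithTop ℝ) ≤ b := WithTop.coe_le_coe.2 hab
  have key : ∀ x t, t ∈ (Action.wait v a c).occ x →
      t ∈ (Action.wait v a b).occ x ∨ t ∈ (Action.wait v b c).occ x := by
    intro x t ht
    rw [Action.mem_occ_wait (hab'.trans hbc)] at ht
    rw [Action.mem_occ_wait hab', Action.mem_occ_wait hbc, WithTop.coe_le_coe]
    rcases le_total t b with h | h
    · exact .inl ⟨ht.1, ht.2.1, h⟩
    · exact .inr ⟨ht.1, h, ht.2.2⟩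
  intro k hk hf
  match k, hf with
  | .wait x l r, ⟨hx, t, ht, hlr⟩ =>
    rcases key _ _ ht with h | h
    · exact h₁ _ hk ⟨hx, t, h, hlr⟩
    · exact h₂ _ hk ⟨hx, t, h, hlr⟩
  | .occupancy x t, ht =>
    rcases key _ _ ht with h | h
    · exact h₁ _ hk h
    · exact h₂ _ hk h

variable (P : MAPFAA I V)

/-! ## The actions of a path -/

variable {P} {i : I}

theorem le_arrivalFrom {l : Plan V} {v : V} {t : ℝ} (h : P.IsPathFrom i v t l) :
    t ≤ P.arrivalFrom i v t l := by
  induction l generalizing v t with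
  | nil => exact le_rfl
  | cons x l ih =>
    obtain ⟨d, w⟩ := x
    have := P.τ_pos i v w h.2.1
    have := ih h.2.2
    have := h.1
    simp only [arrivalFrom]
    linarith

theorem move_mem_actionsFrom {l : Plan V} {v : V} {t : ℝ} (h : P.IsPathFrom i v t l)
    {u w : V} {d e : ℝ} (hA : Action.move u w d e ∈ P.actionsFrom i v t l) :
    P.G.Adj u w ∧ e = d + P.τ i u w ∧ t ≤ d ∧ e ≤ P.arrivalFrom i v t l := by
  induction l generalizing v t with
  | nil => simp [actionsFrom] at hA
  | cons x l ih =>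
    obtain ⟨d', w'⟩ := x
    have h1 := P.τ_pos i v w' h.2.1
    have h2 := h.1
    have h3 := le_arrivalFrom h.2.2
    simp only [actionsFrom, List.mem_cons, reduceCtorEq, Action.move.injEq, false_or] at hA
    simp only [arrivalFrom]
    rcases hA with ⟨rfl, rfl, rfl, rfl⟩ | hA
    · exact ⟨h.2.1, rfl, h2, h3⟩
    · obtain ⟨a, b, c, d⟩ := ih h.2.2 hA
      exact ⟨a, b, by linarith, d⟩

theorem wait_mem_actionsFrom {l : Plan V} {v : V} {t : ℝ} (h : P.IsPathFrom i v t l)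
    {x : V} {a : ℝ} {b : WithTop ℝ} (hA : Action.wait x a b ∈ P.actionsFrom i v t l) :
    t ≤ a ∧ (a : WithTop ℝ) ≤ b ∧ a ≤ P.arrivalFrom i v t l ∧
      (b = ⊤ ∨ ∃ (d : ℝ) (w : V), b = (d : WithTop ℝ) ∧
        Action.move x w d (d + P.τ i x w) ∈ P.actionsFrom i v t l) ∧
      ((x = v ∧ a = t) ∨ ∃ u d, Action.move u x d a ∈ P.actionsFrom i v t l) := by
  induction l generalizing v t with
  | nil =>
    simp only [actionsFrom, List.mem_singleton, Action.wait.injEq] at hA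
    obtain ⟨rfl, rfl, rfl⟩ := hA
    simp [arrivalFrom]
  | cons y l ih =>
    obtain ⟨d', w'⟩ := y
    have h1 := P.τ_pos i v w' h.2.1
    have h2 := h.1
    have h3 := le_arrivalFrom h.2.2
    simp only [actionsFrom, List.mem_cons, reduceCtorEq, Action.wait.injEq, false_or] at hA
    simp only [arrivalFrom]
    rcases hA with ⟨rfl, rfl, rfl⟩ | hA
    · exact ⟨le_rfl, WithTop.coe_le_coe.2 h2, by linarith,
        .inr ⟨d', w', rfl, by simp [actionsFrom]⟩, .inl ⟨rfl, rfl⟩⟩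
    · obtain ⟨p, q, r, s, z⟩ := ih h.2.2 hA
      refine ⟨by linarith, q, r, s.imp_right ?_, .inr ?_⟩
      · rintro ⟨d, w, hb, hm⟩
        exact ⟨d, w, hb, by simp [actionsFrom, hm]⟩
      · rcases z with ⟨rfl, rfl⟩ | ⟨u, d, hm⟩
        · exact ⟨v, d', by simp [actionsFrom]⟩
        · exact ⟨u, d, by simp [actionsFrom, hm]⟩

theorem exists_wait_start_mem (l : Plan V) (v : V) (t : ℝ) :
    ∃ b, Action.wait v t b ∈ P.actionsFrom i v t l := by
  cases l with
  | nil => exact ⟨⊤, by simp [actionsFrom]⟩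
  | cons x l => exact ⟨x.1, by simp [actionsFrom]⟩

theorem exists_wait_of_move_mem {l : Plan V} {v : V} {t : ℝ}
    {u w : V} {d e : ℝ} (hA : Action.move u w d e ∈ P.actionsFrom i v t l) :
    (∃ a, Action.wait u a (d : WithTop ℝ) ∈ P.actionsFrom i v t l) ∧
      ∃ b, Action.wait w e b ∈ P.actionsFrom i v t l := by
  induction l generalizing v t with
  | nil => simp [actionsFrom] at hA
  | cons x l ih =>
    obtain ⟨d', w'⟩ := x
    simp only [actionsFrom, List.mem_cons, reduceCtorEq, Action.move.injEq, false_or] at hA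
    rcases hA with ⟨rfl, rfl, rfl, rfl⟩ | hA
    · obtain ⟨b, hb⟩ := exists_wait_start_mem (P := P) (i := i) l w (d + P.τ i u w)
      exact ⟨⟨t, by simp [actionsFrom]⟩, b, by simp [actionsFrom, hb]⟩
    · obtain ⟨⟨a, ha⟩, b, hb⟩ := ih hA
      exact ⟨⟨a, by simp [actionsFrom, ha]⟩, b, by simp [actionsFrom, hb]⟩

/-! ## The monoid of times -/

variable (P)

/-- The sums of travel times. -/
def timeMonoid : AddSubmonoid ℝ :=
  AddSubmonoid.closure {x | ∃ i u v, P.G.Adj u v ∧ P.τ i u v = x}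

variable {P}

theorem travelTime_mem {u v : V} (h : P.G.Adj u v) : P.τ i u v ∈ P.timeMonoid :=
  AddSubmonoid.subset_closure ⟨i, u, v, h, rfl⟩

theorem nonneg_of_mem_timeMonoid {x : ℝ} (h : x ∈ P.timeMonoid) : 0 ≤ x := by
  induction h using AddSubmonoid.closure_induction with
  | mem x hx => obtain ⟨i, u, v, h, rfl⟩ := hx; exact (P.τ_pos i u v h).le
  | zero => exact le_rfl
  | add x y _ _ hx hy => exact add_nonneg hx hy

/-- The generators are bounded below by some `δ > 0`, so a nonzero element that is at most `(n + 1)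
* δ` is a generator plus an element that is at most `n * δ`. -/
theorem finite_setOf_mem_closure_le {S : Set ℝ} (hS : S.Finite) (hpos : ∀ x ∈ S, 0 < x) (B : ℝ) :
    {x | x ∈ AddSubmonoid.closure S ∧ x ≤ B}.Finite := by
  obtain ⟨δ, hδ, hle⟩ : ∃ δ > 0, ∀ x ∈ S, δ ≤ x := by
    rcases S.eq_empty_or_nonempty with rfl | hne
    · exact ⟨1, one_pos, by simp⟩
    · obtain ⟨δ, hδ, h⟩ := Set.exists_min_image S id hS hne
      exact ⟨δ, hpos δ hδ, h⟩
  have key : ∀ n : ℕ, {x | x ∈ AddSubmonoid.closure S ∧ x ≤ n * δ}.Finite := by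
    intro n
    induction n with
    | zero =>
      refine (Set.finite_singleton (0 : ℝ)).subset ?_
      rintro x ⟨hx, hx0⟩
      induction hx using AddSubmonoid.closure_induction_left with
      | zero => rfl
      | add_left x hx y hy _ =>
        exfalso
        have : 0 ≤ y := AddSubmonoid.closure_induction (motive := fun y _ => 0 ≤ y)
          (fun z hz => (hpos z hz).le) le_rfl (fun _ _ _ _ => add_nonneg) hy
        have := hpos x hx
        simp at hx0
        linarith
    | succ n ih =>
      refine ((Set.finite_singleton (0 : ℝ)).union (Set.Finite.image2 (· + ·) hS ih)).subset ?_
      rintro x ⟨hx, hxn⟩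
      induction hx using AddSubmonoid.closure_induction_left with
      | zero => exact .inl rfl
      | add_left x hx y hy _ =>
        refine .inr ⟨x, hx, y, ⟨hy, ?_⟩, rfl⟩
        have := hle x hx
        push_cast at hxn
        linarith
  obtain ⟨n, hn⟩ := exists_nat_ge (B / δ)
  refine (key n).subset fun x hx => ⟨hx.1, hx.2.trans ?_⟩
  rwa [div_le_iff₀ hδ] at hn

variable [Finite I] [Finite V]

variable (P) in
theorem finite_timeMonoid_le (B : ℝ) : {x | x ∈ P.timeMonoid ∧ x ≤ B}.Finite := by
  refine finite_setOf_mem_closure_le ?_ ?_ B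
  · refine (Set.finite_range fun x : I × V × V => P.τ x.1 x.2.1 x.2.2).subset ?_
    rintro _ ⟨i, u, v, -, rfl⟩
    exact ⟨(i, u, v), rfl⟩
  · rintro _ ⟨i, u, v, h, rfl⟩
    exact P.τ_pos i u v h

theorem exists_timeMonoid_floor {x : ℝ} (hx : 0 ≤ x) :
    ∃ k ∈ P.timeMonoid, k ≤ x ∧ ∀ m ∈ P.timeMonoid, m ≤ x → m ≤ k := by
  obtain ⟨k, hk, h⟩ := Set.exists_max_image _ id (P.finite_timeMonoid_le x) ⟨0, zero_mem _, hx⟩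
  exact ⟨k, hk.1, hk.2, fun m hm hmx => h m ⟨hm, hmx⟩⟩

theorem exists_min_of_subset_timeMonoid {S : Set ℝ} (hS : ∀ x ∈ S, x ∈ P.timeMonoid)
    (hne : S.Nonempty) : ∃ x ∈ S, ∀ y ∈ S, x ≤ y := by
  obtain ⟨z, hz⟩ := hne
  obtain ⟨x, hx, h⟩ := Set.exists_min_image {x | x ∈ S ∧ x ≤ z} id
    ((P.finite_timeMonoid_le z).subset fun x hx => ⟨hS x hx.1, hx.2⟩) ⟨z, hz, le_rfl⟩
  refine ⟨x, hx.1, fun y hy => ?_⟩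
  rcases le_total y z with hyz | hyz
  · exact h y ⟨hy, hyz⟩
  · exact hx.2.trans hyz

end MAPFAA

namespace MAPFAA

variable {I V : Type*} {P : MAPFAA I V} {i : I}

/-! ## Times of paths -/

theorem time_mem_of_mem_actionsFrom {l : Plan V} {v : V} {t : ℝ} (h : P.IsPathFrom i v t l)
    (ht : t ∈ P.timeMonoid) (hl : ∀ x ∈ l, x.1 ∈ P.timeMonoid) {A : Action V}
    (hA : A ∈ P.actionsFrom i v t l) :
    A.startTime ∈ P.timeMonoid ∧ ∀ e : ℝ, A.endTime = e → e ∈ P.timeMonoid := by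
  induction l generalizing v t with
  | nil =>
    simp only [actionsFrom, List.mem_singleton] at hA
    subst hA
    exact ⟨ht, by simp [Action.endTime]⟩
  | cons x l ih =>
    obtain ⟨d, w⟩ := x
    have hd : d ∈ P.timeMonoid := hl _ (List.mem_cons_self ..)
    have he : d + P.τ i v w ∈ P.timeMonoid := add_mem hd (travelTime_mem h.2.1)
    simp only [actionsFrom, List.mem_cons] at hA
    rcases hA with rfl | rfl | hA
    · refine ⟨ht, fun e h => ?_⟩
      rwa [← WithTop.coe_inj.1 h]
    · refine ⟨hd, fun e h => ?_⟩
      rwa [← WithTop.coe_inj.1 h]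
    · exact ih h.2.2 he (fun x hx => hl x (List.mem_cons_of_mem _ hx)) hA

theorem arrivalFrom_mem {l : Plan V} {v : V} {t : ℝ} (h : P.IsPathFrom i v t l)
    (ht : t ∈ P.timeMonoid) (hl : ∀ x ∈ l, x.1 ∈ P.timeMonoid) :
    P.arrivalFrom i v t l ∈ P.timeMonoid := by
  induction l generalizing v t with
  | nil => exact ht
  | cons x l ih =>
    exact ih h.2.2 (add_mem (hl _ (List.mem_cons_self ..)) (travelTime_mem h.2.1))
      (fun x hx => hl x (List.mem_cons_of_mem _ hx))

/-! ## The planner -/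

variable (P) in
/-- The times from which the constraint, imposed on agent `i`, lets this agent depart again are sums of
travel times. -/
def EndsInTimeMonoid (i : I) : Constraint V → Prop
  | .motion _ _ _ r => r ∈ P.timeMonoid
  | .wait v _ r => ∀ u, P.G.Adj u v → r - P.τ i u v ∈ P.timeMonoid
  | .occupancy _ t => t ∈ P.timeMonoid

/-- Only the end of a forbidden window could separate `k` from `d`. That end, moved back by the
travel time for a wait at the target, is an element of the monoid at most `d`, hence at most `k`:
the window is already over for `k`. -/
theorem Feasible.push_down {C : Set (Constraint V)} (hC : ∀ c ∈ C, P.EndsInTimeMonoid i c)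
    {v w : V} (hvw : P.G.Adj v w) {t d k : ℝ} (h : P.Feasible i C v t w d) (htk : t ≤ k)
    (hkd : k ≤ d) (hk : ∀ m ∈ P.timeMonoid, m ≤ d → m ≤ k) :
    P.Feasible i C v t w k ∧
      Allowed C (.wait w (k + P.τ i v w) ((d + P.τ i v w : ℝ) : WithTop ℝ)) := by
  have hτ := P.τ_pos i v w hvw
  obtain ⟨htd, hwait, hmove, hrest⟩ := h
  have hstay : Allowed C (.wait w (k + P.τ i v w) ((d + P.τ i v w : ℝ) : WithTop ℝ)) := by
    intro c hc hf
    match c, hf with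
    | .wait x l r, ⟨hx, z, hz, hlz, hzr⟩ =>
      have hr := hC _ hc v (hx ▸ hvw)
      have hn : ¬ (l ≤ d + P.τ i v w ∧ d + P.τ i v w < r) := fun hn =>
        hrest _ hc ⟨hx, d + P.τ i v w, by
          rw [Action.mem_occ_wait le_rfl]; exact ⟨hx.symm, le_rfl, le_rfl⟩, hn⟩
      rw [Action.mem_occ_wait (WithTop.coe_le_coe.2 (by linarith)), WithTop.coe_le_coe] at hz
      subst hx
      -- The arrival for `d` avoids the window although `z` before it does not, so the window ends
      -- by then and `r - τ ≤ d`. Rounding gives `r ≤ k + τ ≤ z`, against `z < r`.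
      have := hk _ hr (by
        by_contra hlt
        exact hn ⟨by linarith [hz.2.2], by linarith⟩)
      linarith [hz.2.1]
    | .occupancy x z, hf =>
      have hz' := hC _ hc
      have hn := hmove _ hc
      have hf' := hf
      simp only [Constraint.Forbids] at hn hf'
      rw [Action.mem_occ_wait (WithTop.coe_le_coe.2 (by linarith)), WithTop.coe_le_coe] at hf'
      rw [Action.mem_occ_move (by linarith)] at hn
      have := hk z hz' (by
        by_contra hlt
        exact hn (.inr ⟨hf'.1, by linarith, hf'.2.2⟩))
      linarith [hf'.2.1]
  refine ⟨⟨htk, hwait.mono_wait le_rfl (WithTop.coe_le_coe.2 htk) (WithTop.coe_le_coe.2 hkd), ?_,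
    hstay.mono_wait le_rfl le_rfl (WithTop.coe_le_coe.2 (by linarith))⟩, hstay⟩
  intro c hc hf
  match c, hf with
  | .motion s e l r, ⟨h1, h2, h3, h4⟩ =>
    have := hk r (hC _ hc) (by
      by_contra hlt
      exact hmove _ hc ⟨h1, h2, by linarith, by linarith⟩)
    linarith
  | .occupancy x z, hf =>
    have hz' : z ∈ P.timeMonoid := hC _ hc
    have hn := hmove _ hc
    have hw := hwait _ hc
    simp only [Constraint.Forbids] at hn hf hw
    rw [Action.mem_occ_move (by linarith)] at hn hf
    rw [Action.mem_occ_wait (WithTop.coe_le_coe.2 htd), WithTop.coe_le_coe] at hw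
    rcases hf with ⟨hx, h1, h2⟩ | ⟨hx, h1, h2⟩
    · rcases le_or_gt d z with h | h
      · exact hn (.inl ⟨hx, h, by linarith⟩)
      · exact hw ⟨hx, by linarith, h.le⟩
    · rcases le_or_gt z d with h | h
      · linarith [hk z hz' h]
      · exact hn (.inr ⟨hx, h, by linarith⟩)

/-! ### Soundness and completeness of the planner -/

theorem GeneratedFrom.isPathFrom {C : Set (Constraint V)} {soft : V → Set ℝ} {l : Plan V} {v : V}
    {t : ℝ} (h : P.GeneratedFrom i C soft v t l) : P.IsPathFrom i v t l := by
  induction l generalizing v t with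
  | nil => exact h.1
  | cons x l ih =>
    obtain ⟨hadj, ⟨b, -, hb⟩, hl⟩ := h
    exact ⟨hb.1.1, hadj, ih hl⟩

theorem GeneratedFrom.allowed {C : Set (Constraint V)} {soft : V → Set ℝ} {l : Plan V} {v : V}
    {t : ℝ} (h : P.GeneratedFrom i C soft v t l) {A : Action V}
    (hA : A ∈ P.actionsFrom i v t l) : Allowed C A := by
  induction l generalizing v t with
  | nil =>
    simp only [actionsFrom, List.mem_singleton] at hA
    exact hA ▸ h.2
  | cons x l ih =>
    obtain ⟨hadj, ⟨b, -, hb⟩, hl⟩ := h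
    simp only [actionsFrom, List.mem_cons] at hA
    rcases hA with rfl | rfl | hA
    · exact hb.1.2.1
    · exact hb.1.2.2.1
    · exact ih hl hA

variable [Finite I] [Finite V]

/-- Since `b` and `t` lie in the monoid, the rounded departure is still not before them and arrives
in the same safe interval; minimality makes it equal to `d`. -/
theorem EarliestDeparture.mem_timeMonoid {C : Set (Constraint V)}
    (hC : ∀ c ∈ C, P.EndsInTimeMonoid i c) {v w : V} (hvw : P.G.Adj v w) {b t d : ℝ}
    (hb : b ∈ P.timeMonoid) (ht : t ∈ P.timeMonoid) (h : P.EarliestDeparture i C b v t w d) :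
    d ∈ P.timeMonoid := by
  obtain ⟨hf, hbd, hmin⟩ := h
  obtain ⟨k, hkM, hkd, hk⟩ :=
    exists_timeMonoid_floor (P := P) ((nonneg_of_mem_timeMonoid ht).trans hf.1)
  obtain ⟨h1, h2⟩ := hf.push_down hC hvw (hk t ht hf.1) hkd hk
  rcases hkd.lt_or_eq with hlt | rfl
  · exact absurd h2 (hmin k h1 (hk b hb hbd) hlt)
  · exact hkM

theorem GeneratedFrom.mem_timeMonoid {C : Set (Constraint V)}
    (hC : ∀ c ∈ C, P.EndsInTimeMonoid i c) {soft : V → Set ℝ}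
    (hsoft : ∀ w, ∀ b ∈ soft w, b ∈ P.timeMonoid) {l : Plan V} {v : V} {t : ℝ}
    (ht : t ∈ P.timeMonoid) (h : P.GeneratedFrom i C soft v t l) :
    ∀ x ∈ l, x.1 ∈ P.timeMonoid := by
  induction l generalizing v t with
  | nil => simp
  | cons x l ih =>
    obtain ⟨d, w⟩ := x
    obtain ⟨hadj, ⟨b, hbs, hb⟩, hl⟩ := h
    have hbM : b ∈ P.timeMonoid := hbs.elim (fun h => h ▸ ht) (hsoft w b)
    have hd := hb.mem_timeMonoid hC hadj hbM ht
    rintro x hx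
    rcases List.mem_cons.1 hx with rfl | hx
    · exact hd
    · exact ih (add_mem hd (travelTime_mem hadj)) hl x hx

theorem exists_earliestDeparture {C : Set (Constraint V)} (hC : ∀ c ∈ C, P.EndsInTimeMonoid i c)
    {v w : V} (hvw : P.G.Adj v w) {t d : ℝ} (ht : t ∈ P.timeMonoid)
    (h : P.Feasible i C v t w d) :
    ∃ k ∈ P.timeMonoid, k ≤ d ∧ P.EarliestDeparture i C t v t w k ∧
      Allowed C (.wait w (k + P.τ i v w) ((d + P.τ i v w : ℝ) : WithTop ℝ)) := by
  have floor : ∀ d', P.Feasible i C v t w d' → ∃ k ∈ P.timeMonoid, k ≤ d' ∧ P.Feasible i C v t w k ∧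
      Allowed C (.wait w (k + P.τ i v w) ((d' + P.τ i v w : ℝ) : WithTop ℝ)) := by
    intro d' h
    obtain ⟨k, hkM, hkd, hk⟩ :=
    exists_timeMonoid_floor (P := P) ((nonneg_of_mem_timeMonoid ht).trans h.1)
    obtain ⟨h1, h2⟩ := h.push_down hC hvw (hk t ht h.1) hkd hk
    exact ⟨k, hkM, hkd, h1, h2⟩
  obtain ⟨k, ⟨hkM, hkd, hkf, hka⟩, hmin⟩ := exists_min_of_subset_timeMonoid (P := P)
    (S := {k | k ∈ P.timeMonoid ∧ k ≤ d ∧ P.Feasible i C v t w k ∧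
      Allowed C (.wait w (k + P.τ i v w) ((d + P.τ i v w : ℝ) : WithTop ℝ))})
    (fun _ h => h.1) (floor d h)
  refine ⟨k, hkM, hkd, ⟨hkf, hkf.1, fun d' hd' _ hlt hall => ?_⟩, hka⟩
  obtain ⟨m, hmM, hmd, hmf, hma⟩ := floor d' hd'
  -- The waits between the arrivals for `m`, `d'`, `k` and `d` join up, so `m` competes with `k`,
  -- although `m ≤ d' < k`. The rounding is needed because `k` is minimal only within the monoid.
  have hle := hmin m ⟨hmM, by linarith, hmf,
    (hma.wait_trans hall (by linarith) (WithTop.coe_le_coe.2 (by linarith))).wait_trans hka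
      (by linarith) (WithTop.coe_le_coe.2 (by linarith))⟩
  linarith

/-- Exchange argument: each departure is replaced by the earliest one for its safe interval. The
induction carries an earlier arrival `t'` and the permission to wait from `t'` to `t`, from which
the given schedule remains feasible. -/
theorem exists_generatedFrom_le {C : Set (Constraint V)} (hC : ∀ c ∈ C, P.EndsInTimeMonoid i c)
    (soft : V → Set ℝ) {l : Plan V} {v : V} {t t' : ℝ} (ht' : t' ∈ P.timeMonoid) (htt' : t' ≤ t)
    (hwait : Allowed C (.wait v t' (t : WithTop ℝ))) (hl : P.IsPathFrom i v t l)
    (hall : ∀ A ∈ P.actionsFrom i v t l, Allowed C A) :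
    ∃ q, P.GeneratedFrom i C soft v t' q ∧ P.arrivalFrom i v t' q ≤ P.arrivalFrom i v t l := by
  induction l generalizing v t t' with
  | nil =>
    exact ⟨[], ⟨hl, hwait.wait_trans (hall _ (by simp [actionsFrom])) htt' le_top⟩, htt'⟩
  | cons x l ih =>
    obtain ⟨d, w⟩ := x
    obtain ⟨htd, hadj, hl⟩ := hl
    simp only [actionsFrom, List.mem_cons, forall_eq_or_imp] at hall
    obtain ⟨h1, h2, h3⟩ := hall
    obtain ⟨b, hb⟩ := exists_wait_start_mem (P := P) (i := i) l w (d + P.τ i v w)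
    have hf : P.Feasible i C v t' w d := by
      refine ⟨htt'.trans htd, hwait.wait_trans h1 htt' (WithTop.coe_le_coe.2 htd), h2, ?_⟩
      exact (h3 _ hb).mono_wait le_rfl le_rfl (wait_mem_actionsFrom hl hb).2.1
    obtain ⟨k, hkM, hkd, hke, hka⟩ := exists_earliestDeparture hC hadj ht' hf
    obtain ⟨q, hq, hle⟩ := ih (add_mem hkM (travelTime_mem hadj)) (by linarith) hka hl h3
    exact ⟨(k, w) :: q, ⟨hadj, ⟨t', .inl rfl, hke⟩, hq⟩, hle⟩

theorem exists_generated_le {C : Set (Constraint V)} (hC : ∀ c ∈ C, P.EndsInTimeMonoid i c)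
    (soft : V → Set ℝ) {p : Plan V} (hp : P.IsPath i p) (hall : ∀ A ∈ P.actions i p, Allowed C A) :
    ∃ q, P.Generated i C soft q ∧ P.cost i q ≤ P.cost i p := by
  obtain ⟨b, hb⟩ := exists_wait_start_mem (P := P) (i := i) p (P.start i) 0
  exact exists_generatedFrom_le hC soft (zero_mem _) le_rfl
    ((hall _ hb).mono_wait le_rfl le_rfl (wait_mem_actionsFrom hp hb).2.1) hp hall

/-- The costs of generated paths lie in the monoid, so their minimum is attained. -/
theorem exists_lowLevelPlan {C : Set (Constraint V)} (hC : ∀ c ∈ C, P.EndsInTimeMonoid i c)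
    {soft : V → Set ℝ} (hsoft : ∀ w, ∀ b ∈ soft w, b ∈ P.timeMonoid)
    (h : ∃ p, P.Generated i C soft p) : ∃ p, P.LowLevelPlan i C soft p := by
  obtain ⟨_, ⟨p, hp, rfl⟩, hmin⟩ := exists_min_of_subset_timeMonoid (P := P)
    (S := P.cost i '' {p | P.Generated i C soft p}) (by
      rintro _ ⟨p, hp, rfl⟩
      exact arrivalFrom_mem (GeneratedFrom.isPathFrom hp) (zero_mem _)
        (GeneratedFrom.mem_timeMonoid hC hsoft (zero_mem _) hp))
    (Set.Nonempty.image _ h)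
  exact ⟨p, hp, fun q hq => hmin _ ⟨q, hq, rfl⟩⟩

end MAPFAA

namespace MAPFAA

variable {I V : Type*} {P : MAPFAA I V} {i : I}

/-! ## Resting at a vertex -/

variable (P) in
/-- Agent `i`, executing `p`, waits at `v` during a closed interval that contains `z`. -/
def RestsAt (i : I) (p : Plan V) (v : V) (z : ℝ) : Prop :=
  ∃ a b, Action.wait v a b ∈ P.actions i p ∧ a ≤ z ∧ (z : WithTop ℝ) ≤ b

/-- A wait is preceded by a move of duration `c` into the vertex or by the start at time `0`, and
followed by a move of duration `c` out of it or by nothing. -/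
theorem RestsAt.occupies {p : Plan V} {c : ℝ} (hp : P.IsPath i p)
    (hc : ∀ u v, P.G.Adj u v → P.τ i u v = c) {v : V} {z t : ℝ} (h : P.RestsAt i p v z)
    (ht : 0 ≤ t) (h1 : z - c < t) (h2 : t < z + c) : P.Occupies i p v t := by
  obtain ⟨a, b, hA, haz, hzb⟩ := h
  obtain ⟨-, hab, -, hend, hstart⟩ := wait_mem_actionsFrom hp hA
  rcases lt_or_ge t a with hta | hta
  · rcases hstart with ⟨-, rfl⟩ | ⟨u, d, hm⟩
    · linarith
    · obtain ⟨hadj, rfl, -, -⟩ := move_mem_actionsFrom hp hm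
      refine ⟨_, hm, (Action.mem_occ_move (by linarith [P.τ_pos i u v hadj])).2
        (.inr ⟨rfl, ?_, hta.le⟩)⟩
      rw [hc u v hadj] at haz
      linarith
  · rcases le_or_gt (t : WithTop ℝ) b with htb | htb
    · exact ⟨_, hA, (Action.mem_occ_wait hab).2 ⟨rfl, hta, htb⟩⟩
    · rcases hend with rfl | ⟨d, w, rfl, hm⟩
      · exact absurd le_top htb.not_ge
      · have hadj := (move_mem_actionsFrom hp hm).1
        rw [WithTop.coe_lt_coe] at htb
        rw [WithTop.coe_le_coe] at hzb
        refine ⟨_, hm, (Action.mem_occ_move (by linarith [P.τ_pos i v w hadj])).2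
          (.inl ⟨rfl, htb.le, ?_⟩)⟩
        rw [hc v w hadj]
        linarith

theorem RestsAt.nonneg {p : Plan V} (hp : P.IsPath i p) {v : V} {z : ℝ} (h : P.RestsAt i p v z) :
    0 ≤ z := by
  obtain ⟨a, b, hA, haz, -⟩ := h
  exact (wait_mem_actionsFrom hp hA).1.trans haz

/-- The intervals of radius `ci` around `y` and `cj` around `z` overlap. The common time must also
be positive, which is possible because `y` and `z` are nonnegative. -/
theorem ConflictFree.not_restsAt {π : JointPlan I V} (hfree : P.ConflictFree π)
    (hπ : ∀ i, P.IsPath i (π i)) {i j : I} (hij : i ≠ j) {ci cj : ℝ} (hi0 : 0 < ci) (hj0 : 0 < cj)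
    (hci : ∀ u v, P.G.Adj u v → P.τ i u v = ci) (hcj : ∀ u v, P.G.Adj u v → P.τ j u v = cj)
    {v : V} {y z : ℝ} (hy : P.RestsAt i (π i) v y) (hz : P.RestsAt j (π j) v z)
    (h1 : y < z + ci + cj) (h2 : z < y + ci + cj) : False := by
  have hy0 := hy.nonneg (hπ i)
  have hz0 := hz.nonneg (hπ j)
  obtain ⟨t, hlo, hhi⟩ : ∃ t, max (max (y - ci) (z - cj)) 0 < t ∧ t < min (y + ci) (z + cj) := by
    apply exists_between
    refine lt_min (max_lt (max_lt ?_ ?_) ?_) (max_lt (max_lt ?_ ?_) ?_) <;> linarith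
  simp only [max_lt_iff, lt_min_iff] at hlo hhi
  exact hfree i j hij v t ⟨hy.occupies (hπ i) hci hlo.2.le hlo.1.1 hhi.1,
    hz.occupies (hπ j) hcj hlo.2.le hlo.1.2 hhi.2⟩

/-! ### Rest times forced by violated constraints -/

theorem exists_restsAt_of_forbids_motion_into {p : Plan V} {c : ℝ} (hp : P.IsPath i p)
    (hc : ∀ u v, P.G.Adj u v → P.τ i u v = c) {v : V} {l r : ℝ} {A : Action V}
    (hA : A ∈ P.actions i p) (h : (Constraint.motion none (some v) l r).Forbids A) :
    ∃ x, P.RestsAt i p v (x + c) ∧ l ≤ x ∧ x < r := by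
  match A, h with
  | .move u w x e, ⟨_, hw, hl, hr⟩ =>
    obtain rfl := hw v rfl
    obtain ⟨hadj, rfl, -, -⟩ := move_mem_actionsFrom hp hA
    obtain ⟨-, b, hb⟩ := exists_wait_of_move_mem hA
    rw [hc u v hadj] at hb
    exact ⟨x, ⟨_, b, hb, le_rfl, (wait_mem_actionsFrom hp hb).2.1⟩, hl, hr⟩

theorem exists_restsAt_of_forbids_motion_out {p : Plan V} (hp : P.IsPath i p)
    {v : V} {l r : ℝ} {A : Action V}
    (hA : A ∈ P.actions i p) (h : (Constraint.motion (some v) none l r).Forbids A) :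
    ∃ x, P.RestsAt i p v x ∧ l ≤ x ∧ x < r := by
  match A, h with
  | .move u w x e, ⟨hu, _, hl, hr⟩ =>
    obtain rfl := hu v rfl
    obtain ⟨⟨a, ha⟩, -⟩ := exists_wait_of_move_mem hA
    have := WithTop.coe_le_coe.1 (wait_mem_actionsFrom hp ha).2.1
    exact ⟨x, ⟨a, x, ha, this, le_rfl⟩, hl, hr⟩

theorem exists_restsAt_of_forbids_wait {p : Plan V} (hp : P.IsPath i p)
    {v : V} {l r : ℝ} {A : Action V}
    (hA : A ∈ P.actions i p) (h : (Constraint.wait v l r).Forbids A) :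
    ∃ x, P.RestsAt i p v x ∧ l ≤ x ∧ x < r := by
  match A, h with
  | .wait u a b, ⟨hu, x, hx, hl, hr⟩ =>
    subst hu
    rw [Action.mem_occ_wait (wait_mem_actionsFrom hp hA).2.1] at hx
    exact ⟨x, ⟨a, b, hA, hx.2⟩, hl, hr⟩

/-! ## Properties of the generated constraints -/

theorem τin_eq {c : ℝ} (hc : ∀ u v, P.G.Adj u v → P.τ i u v = c) {u v : V} (h : P.G.Adj u v) :
    P.τin i v = c := by
  have : Nonempty {u // P.G.Adj u v} := ⟨⟨u, h⟩⟩
  have : ∀ x : {u // P.G.Adj u v}, P.τ i x v = c := fun x => hc _ _ x.2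
  simp only [τin, this, ciInf_const]

theorem τout_eq {c : ℝ} (hc : ∀ u v, P.G.Adj u v → P.τ i u v = c) {u v : V} (h : P.G.Adj u v) :
    P.τout i v = c := by
  have : Nonempty {u // P.G.Adj v u} := ⟨⟨u, h.symm⟩⟩
  have : ∀ x : {u // P.G.Adj v u}, P.τ i v x = c := fun x => hc _ _ x.2
  simp only [τout, this, ciInf_const]

theorem Conflict.adj_actI {c : Conflict I V} {p : Plan V} (hp : P.IsPath c.agentI p)
    (h : c.actI ∈ P.actions c.agentI p) : ∃ u, P.G.Adj u c.vertex := by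
  cases c <;> exact ⟨_, (move_mem_actionsFrom hp h).1⟩

/-- The two motion windows make each move depart before the other one ends, so both agents are at
the vertex at some time. For WAIT-IN both sides name the same vertex and time point. -/
theorem singleConstraints_disjoint {c : Conflict I V} {π : JointPlan I V}
    (hπ : ∀ i, P.IsPath i (π i)) (hI : c.actI ∈ P.actions c.agentI (π c.agentI))
    (hJ : c.actJ ∈ P.actions c.agentJ (π c.agentJ)) (hne : c.agentI ≠ c.agentJ)
    {σ : JointPlan I V} (hσ : P.IsSolution σ) {A B : Action V}
    (hA : A ∈ P.actions c.agentI (σ c.agentI)) (hB : B ∈ P.actions c.agentJ (σ c.agentJ))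
    {k k' : Constraint V} (hk : k ∈ (singleConstraints c).1) (hk' : k' ∈ (singleConstraints c).2)
    (hkA : k.Forbids A) (hkB : k'.Forbids B) : False := by
  have hfree := hσ.2 c.agentI c.agentJ hne
  cases c with
  | inIn i j v u w a a' b b' =>
    simp only [Conflict.agentI, Conflict.agentJ, Conflict.actI, Conflict.actJ] at *
    obtain ⟨hadj, rfl, -, -⟩ := move_mem_actionsFrom (hπ _) hI
    obtain ⟨hadj', rfl, -, -⟩ := move_mem_actionsFrom (hπ _) hJ
    obtain rfl := hk
    obtain rfl := hk'
    match A, B, hkA, hkB with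
    | .move u₁ v₁ x e, .move u₂ v₂ y f, ⟨hu, hv, hl, hr⟩, ⟨hu', hv', hl', hr'⟩ =>
      obtain rfl := hu u rfl
      obtain rfl := hv v rfl
      obtain rfl := hu' w rfl
      obtain rfl := hv' v rfl
      obtain ⟨-, rfl, -, -⟩ := move_mem_actionsFrom (hσ.1 _) hA
      obtain ⟨-, rfl, -, -⟩ := move_mem_actionsFrom (hσ.1 _) hB
      have h1 := P.τ_pos i u v hadj
      have h2 := P.τ_pos j w v hadj'
      -- At the first of the two arrivals the other agent has already departed towards `v`.
      refine hfree v (min (x + P.τ i u v) (y + P.τ j w v)) ⟨⟨_, hA, ?_⟩, ⟨_, hB, ?_⟩⟩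
      · refine (Action.mem_occ_move (by linarith)).2 (.inr ⟨rfl, lt_min ?_ ?_, min_le_left _ _⟩)
          <;> linarith
      · refine (Action.mem_occ_move (by linarith)).2 (.inr ⟨rfl, lt_min ?_ ?_, min_le_right _ _⟩)
          <;> linarith
  | outIn i j v u w a a' b b' =>
    simp only [Conflict.agentI, Conflict.agentJ, Conflict.actI, Conflict.actJ] at *
    obtain ⟨hadj, rfl, -, -⟩ := move_mem_actionsFrom (hπ _) hI
    obtain ⟨hadj', rfl, -, -⟩ := move_mem_actionsFrom (hπ _) hJ
    obtain rfl := hk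
    obtain rfl := hk'
    match A, B, hkA, hkB with
    | .move u₁ v₁ x e, .move u₂ v₂ y f, ⟨hu, hv, hl, hr⟩, ⟨hu', hv', hl', hr'⟩ =>
      obtain rfl := hu u rfl
      obtain rfl := hv v rfl
      obtain rfl := hu' v rfl
      obtain rfl := hv' w rfl
      obtain ⟨-, rfl, -, -⟩ := move_mem_actionsFrom (hσ.1 _) hA
      obtain ⟨-, rfl, -, -⟩ := move_mem_actionsFrom (hσ.1 _) hB
      have h1 := P.τ_pos i u v hadj
      have h2 := P.τ_pos j v w hadj'
      obtain ⟨t, ht1, ht2⟩ : ∃ t, max x y < t ∧ t < min (x + P.τ i u v) (y + P.τ j v w) := by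
        apply exists_between
        simp only [max_lt_iff, lt_min_iff]
        refine ⟨⟨?_, ?_⟩, ?_, ?_⟩ <;> linarith
      simp only [max_lt_iff, lt_min_iff] at ht1 ht2
      refine hfree v t ⟨⟨_, hA, ?_⟩, ⟨_, hB, ?_⟩⟩
      · exact (Action.mem_occ_move (by linarith)).2 (.inr ⟨rfl, ht1.1, ht2.1.le⟩)
      · exact (Action.mem_occ_move (by linarith)).2 (.inl ⟨rfl, ht1.2.le, ht2.2⟩)
  | waitIn i j v u a a' b b' =>
    obtain rfl := hk
    obtain rfl := hk'
    exact hfree v _ ⟨⟨A, hA, hkA⟩, ⟨B, hB, hkB⟩⟩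

/-- Every violation yields a rest time at the vertex: the arrival of a move into it, the departure
of a move out of it, or a time of a wait. The windows keep the two rest times less than `ci + cj`
apart. -/
theorem multiConstraints_disjoint (hP : P.EqualTravelTimes) {c : Conflict I V} {u : V}
    (hadj : P.G.Adj u c.vertex) (hne : c.agentI ≠ c.agentJ)
    {σ : JointPlan I V} (hσ : P.IsSolution σ) {A B : Action V}
    (hA : A ∈ P.actions c.agentI (σ c.agentI)) (hB : B ∈ P.actions c.agentJ (σ c.agentJ))
    {k k' : Constraint V} (hk : k ∈ (P.multiConstraints c).1) (hk' : k' ∈ (P.multiConstraints c).2)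
    (hkA : k.Forbids A) (hkB : k'.Forbids B) : False := by
  obtain ⟨ci, hci⟩ := hP c.agentI
  obtain ⟨cj, hcj⟩ := hP c.agentJ
  have hi0 : 0 < ci := hci _ _ hadj ▸ P.τ_pos _ _ _ hadj
  have hj0 : 0 < cj := hcj _ _ hadj ▸ P.τ_pos _ _ _ hadj
  have hin_i := τin_eq hci hadj
  have hin_j := τin_eq hcj hadj
  have hout_i := τout_eq hci hadj
  have hout_j := τout_eq hcj hadj
  have key := @ConflictFree.not_restsAt _ _ P σ hσ.2 hσ.1 _ _ hne _ _ hi0 hj0 hci hcj c.vertex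
  have hpI := hσ.1 c.agentI
  have hpJ := hσ.1 c.agentJ
  cases c with
  | inIn i j v u w a a' b b' =>
    simp only [Conflict.agentI, Conflict.agentJ, Conflict.vertex] at *
    simp only [multiConstraints, Set.mem_singleton_iff, hin_i, hin_j, hout_i, hout_j] at hk hk'
    subst hk hk'
    obtain ⟨x, hx, hx1, hx2⟩ := exists_restsAt_of_forbids_motion_into hpI hci hA hkA
    obtain ⟨y, hy, hy1, hy2⟩ := exists_restsAt_of_forbids_motion_into hpJ hcj hB hkB
    exact key hx hy (by linarith) (by linarith)
  | outIn i j v u w a a' b b' =>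
    simp only [Conflict.agentI, Conflict.agentJ, Conflict.vertex] at *
    simp only [multiConstraints, Set.mem_singleton_iff, Set.mem_insert_iff, hin_i, hin_j, hout_i,
      hout_j] at hk hk'
    subst hk
    obtain ⟨x, hx, hx1, hx2⟩ := exists_restsAt_of_forbids_motion_into hpI hci hA hkA
    obtain ⟨y, hy, hy1, hy2⟩ : ∃ y, P.RestsAt j (σ j) v y ∧ b ≤ y ∧ y < a + ci + ci + cj := by
      rcases hk' with rfl | rfl
      · exact exists_restsAt_of_forbids_wait hpJ hB hkB
      · exact exists_restsAt_of_forbids_motion_out hpJ hB hkB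
    exact key hx hy (by linarith) (by linarith)
  | waitIn i j v u a a' b b' =>
    simp only [Conflict.agentI, Conflict.agentJ, Conflict.vertex] at *
    simp only [multiConstraints, hin_i, hin_j, hout_i, hout_j] at hk hk'
    split_ifs at hk hk'
    all_goals
      simp only [Set.mem_singleton_iff] at hk hk'
      subst hk hk'
      obtain ⟨x, hx, hx1, hx2⟩ := exists_restsAt_of_forbids_motion_into hpI hci hA hkA
      obtain ⟨y, hy, hy1, hy2⟩ := exists_restsAt_of_forbids_wait hpJ hB hkB
      exact key hx hy (by linarith) (by linarith)

theorem generateConstraints_disjoint {m : Method} (hm : m = .multi → P.EqualTravelTimes)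
    {c : Conflict I V} {π : JointPlan I V}
    (hπ : ∀ i, P.IsPath i (π i)) (hI : c.actI ∈ P.actions c.agentI (π c.agentI))
    (hJ : c.actJ ∈ P.actions c.agentJ (π c.agentJ)) (hne : c.agentI ≠ c.agentJ)
    {σ : JointPlan I V} (hσ : P.IsSolution σ) {A B : Action V}
    (hA : A ∈ P.actions c.agentI (σ c.agentI)) (hB : B ∈ P.actions c.agentJ (σ c.agentJ))
    {k k' : Constraint V} (hk : k ∈ (P.generateConstraints m c).1)
    (hk' : k' ∈ (P.generateConstraints m c).2)
    (hkA : k.Forbids A) (hkB : k'.Forbids B) : False := by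
  cases m with
  | single => exact singleConstraints_disjoint hπ hI hJ hne hσ hA hB hk hk' hkA hkB
  | multi =>
    obtain ⟨u, hu⟩ := Conflict.adj_actI (hπ _) hI
    exact multiConstraints_disjoint (hm rfl) hu hne hσ hA hB hk hk' hkA hkB

/-- In an earliest conflict of type OUT-IN the second agent departs before the first one arrives. -/
theorem IsEarliestConflict.departure_lt_arrival {π : JointPlan I V} (hπ : ∀ i, P.IsPath i (π i))
    {i j : I} {v u w : V} {a a' b b' : ℝ}
    (h : P.IsEarliestConflict π (.outIn i j v u w a a' b b')) : b < a' := by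
  obtain ⟨-, hI, hJ, ⟨t, ht⟩, hmin⟩ := h
  simp only [Conflict.agentI, Conflict.agentJ, Conflict.actI, Conflict.actJ, Conflict.overlap,
    Conflict.vertex] at *
  obtain ⟨hadj, rfl, ha, -⟩ := move_mem_actionsFrom (hπ _) hI
  obtain ⟨hadj', rfl, hb, -⟩ := move_mem_actionsFrom (hπ _) hJ
  obtain ⟨⟨s, hs⟩, -⟩ := exists_wait_of_move_mem hJ
  have h1 := P.τ_pos i _ _ hadj
  have h2 := P.τ_pos j _ _ hadj'
  have hocc : ∀ t, t ∈ (Action.move u v a (a + P.τ i u v)).occ v ∩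
      (Action.move v w b (b + P.τ j v w)).occ v → b ≤ t ∧ t ≤ a + P.τ i u v := by
    rintro t ⟨hx, hy⟩
    rw [Action.mem_occ_move (by linarith)] at hx hy
    have := hadj.ne
    have := hadj'.ne
    grind
  obtain ⟨hbt, hta⟩ := hocc t ht
  refine lt_of_le_of_ne (hbt.trans hta) fun heq => ?_
  have hinf := le_csInf ⟨t, ht⟩ fun x hx => (hocc x hx).1
  have hcontra : ∀ t, a < t → t < b → P.Occupies j (π j) v t → False := by
    intro t h3 h4 h5
    have := hmin v t ⟨_, hI, (Action.mem_occ_move (by linarith)).2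
      (.inr ⟨rfl, h3, by linarith⟩)⟩ h5
    linarith
  obtain ⟨hs0, hsb, -, -, hstart⟩ := wait_mem_actionsFrom (hπ j) hs
  rw [WithTop.coe_le_coe] at hsb
  rcases hsb.lt_or_eq with hlt | rfl
  · obtain ⟨t, ht1, ht2⟩ := exists_between (max_lt (show a < b by linarith) hlt)
    rw [max_lt_iff] at ht1
    exact hcontra t ht1.1 ht2 ⟨_, hs, (Action.mem_occ_wait (WithTop.coe_le_coe.2 hsb)).2
      ⟨rfl, ht1.2.le, WithTop.coe_le_coe.2 ht2.le⟩⟩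
  · rcases hstart with ⟨-, rfl⟩ | ⟨x, d, hm⟩
    · linarith
    · obtain ⟨hadj'', heq', -, -⟩ := move_mem_actionsFrom (hπ j) hm
      have h6 := P.τ_pos j _ _ hadj''
      obtain ⟨t, ht1, ht2⟩ := exists_between (max_lt (show a < s by linarith)
        (show d < s by linarith))
      rw [max_lt_iff] at ht1
      exact hcontra t ht1.1 ht2 ⟨_, hm, (Action.mem_occ_move (by linarith)).2
        (.inr ⟨rfl, ht1.2, ht2.le⟩)⟩

/-- This guarantees that neither child repeats constraints of its parent. For OUT-IN, being earliest
is essential with single actions: the window `[b, a')` of the second agent must be nonempty. -/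
theorem IsEarliestConflict.exists_forbidden {m : Method} (hm : m = .multi → P.EqualTravelTimes)
    {c : Conflict I V} {π : JointPlan I V} (hπ : ∀ i, P.IsPath i (π i))
    (h : P.IsEarliestConflict π c) :
    (∃ k ∈ (P.generateConstraints m c).1, ∃ A ∈ P.actions c.agentI (π c.agentI), k.Forbids A) ∧
      ∃ k ∈ (P.generateConstraints m c).2, ∃ A ∈ P.actions c.agentJ (π c.agentJ), k.Forbids A := by
  have hlt := fun i j v u w a a' b b' (hc : c = .outIn i j v u w a a' b b') =>
    (hc ▸ h).departure_lt_arrival hπ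
  obtain ⟨-, hI, hJ, ⟨t, ht⟩, -⟩ := h
  have hequal : m = .multi → ∃ ci cj, 0 < ci ∧ 0 < cj ∧
      (∀ u v, P.G.Adj u v → P.τ c.agentI u v = ci) ∧
      (∀ u v, P.G.Adj u v → P.τ c.agentJ u v = cj) ∧
      P.τin c.agentI c.vertex = ci ∧ P.τout c.agentI c.vertex = ci ∧
      P.τin c.agentJ c.vertex = cj ∧ P.τout c.agentJ c.vertex = cj := by
    intro hmm
    obtain ⟨u, hu⟩ := Conflict.adj_actI (hπ _) hI
    obtain ⟨ci, hci⟩ := hm hmm c.agentI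
    obtain ⟨cj, hcj⟩ := hm hmm c.agentJ
    exact ⟨ci, cj, hci _ _ hu ▸ P.τ_pos _ _ _ hu, hcj _ _ hu ▸ P.τ_pos _ _ _ hu, hci, hcj,
      τin_eq hci hu, τout_eq hci hu, τin_eq hcj hu, τout_eq hcj hu⟩
  cases c with
  | inIn i j v u w a a' b b' =>
    clear hlt
    simp only [Conflict.agentI, Conflict.agentJ, Conflict.actI, Conflict.actJ, Conflict.overlap,
      Conflict.vertex, Set.mem_inter_iff] at *
    obtain ⟨hadj, rfl, -, -⟩ := move_mem_actionsFrom (hπ _) hI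
    obtain ⟨hadj', rfl, -, -⟩ := move_mem_actionsFrom (hπ _) hJ
    have h1 := P.τ_pos i _ _ hadj
    have h2 := P.τ_pos j _ _ hadj'
    have hn1 := hadj.ne
    have hn2 := hadj'.ne
    rw [Action.mem_occ_move (by linarith), Action.mem_occ_move (by linarith)] at ht
    have h3 : a < b + P.τ j w v ∧ b < a + P.τ i u v := by grind
    cases m with
    | single =>
      exact ⟨⟨_, rfl, _, hI, by simp, by simp, le_rfl, h3.1⟩,
        ⟨_, rfl, _, hJ, by simp, by simp, le_rfl, h3.2⟩⟩
    | multi =>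
      obtain ⟨ci, cj, hi0, hj0, hci, hcj, hin_i, hout_i, hin_j, hout_j⟩ := hequal rfl
      rw [hci _ _ hadj, hcj _ _ hadj'] at h3
      exact ⟨⟨_, rfl, _, hI, by simp, by simp, le_rfl, by rw [hin_j, hout_j]; linarith⟩,
        ⟨_, rfl, _, hJ, by simp, by simp, le_rfl, by rw [hin_i, hout_i]; linarith⟩⟩
  | outIn i j v u w a a' b b' =>
    have hba := hlt _ _ _ _ _ _ _ _ _ rfl
    clear hlt
    simp only [Conflict.agentI, Conflict.agentJ, Conflict.actI, Conflict.actJ, Conflict.overlap,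
      Conflict.vertex, Set.mem_inter_iff] at *
    obtain ⟨hadj, rfl, -, -⟩ := move_mem_actionsFrom (hπ _) hI
    obtain ⟨hadj', rfl, -, -⟩ := move_mem_actionsFrom (hπ _) hJ
    obtain ⟨⟨s, hs⟩, -⟩ := exists_wait_of_move_mem hJ
    have h1 := P.τ_pos i _ _ hadj
    have h2 := P.τ_pos j _ _ hadj'
    have hn1 := hadj.ne
    have hn2 := hadj'.ne
    rw [Action.mem_occ_move (by linarith), Action.mem_occ_move (by linarith)] at ht
    have h3 : a < b + P.τ j v w := by grind
    cases m with
    | single =>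
      exact ⟨⟨_, rfl, _, hI, by simp, by simp, le_rfl, h3⟩,
        ⟨_, rfl, _, hJ, by simp, by simp, le_rfl, hba⟩⟩
    | multi =>
      obtain ⟨ci, cj, hi0, hj0, hci, hcj, hin_i, hout_i, hin_j, hout_j⟩ := hequal rfl
      rw [hcj _ _ hadj'] at h3
      rw [hci _ _ hadj] at hba
      exact ⟨⟨_, rfl, _, hI, by simp, by simp, le_rfl, by rw [hout_j]; linarith⟩,
        ⟨_, .inr rfl, _, hJ, by simp, by simp, le_rfl,
          by rw [hin_i, hout_i, hin_j]; linarith⟩⟩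
  | waitIn i j v u a a' b b' =>
    clear hlt
    simp only [Conflict.agentI, Conflict.agentJ, Conflict.actI, Conflict.actJ, Conflict.overlap,
      Conflict.vertex, Set.mem_inter_iff] at *
    obtain ⟨hadj, rfl, -, -⟩ := move_mem_actionsFrom (hπ _) hI
    have hbb := (wait_mem_actionsFrom (hπ _) hJ).2.1
    have h1 := P.τ_pos i _ _ hadj
    have hn1 := hadj.ne
    rw [Action.mem_occ_move (by linarith), Action.mem_occ_wait hbb] at ht
    have h3 : b ≤ a + P.τ i u v := by grind
    have h4 : (a : WithTop ℝ) < b' :=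
      lt_of_lt_of_le (WithTop.coe_lt_coe.2 (by grind)) ht.2.2.2
    cases m with
    | single =>
      refine ⟨⟨_, rfl, _, hI, (Action.mem_occ_move (by linarith)).2
        (.inr ⟨rfl, ?_, min_le_left _ _⟩)⟩, ⟨_, rfl, _, hJ, (Action.mem_occ_wait hbb).2
        ⟨rfl, ?_, ?_⟩⟩⟩
      all_goals
        induction b' using WithTop.recTopCoe with
        | top => simp [h1, h3]
        | coe b' =>
          simp only [WithTop.coe_lt_coe, WithTop.coe_le_coe] at h4 hbb
          simp [h1, h3, h4, hbb]
    | multi =>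
      obtain ⟨ci, cj, hi0, hj0, hci, hcj, hin_i, hout_i, hin_j, hout_j⟩ := hequal rfl
      rw [hci _ _ hadj] at h3
      simp only [generateConstraints, multiConstraints, hin_i, hout_i, hin_j, hout_j]
      split_ifs with hlong
      · induction b' using WithTop.recTopCoe with
        | top => exact absurd hlong (by simp)
        | coe b' =>
          simp only [WithTop.coe_lt_coe, WithTop.coe_le_coe] at h4 hbb hlong
          refine ⟨⟨_, rfl, _, hI, by simp, by simp, le_rfl, ?_⟩, ⟨_, rfl, _, hJ, rfl, b',
            (Action.mem_occ_wait (WithTop.coe_le_coe.2 hbb)).2 ⟨rfl, hbb, le_rfl⟩, le_rfl, hlong⟩⟩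
          simp only [WithTop.untopD_coe]
          linarith
      · refine ⟨⟨_, rfl, _, hI, by simp, by simp, le_rfl, by linarith⟩, ⟨_, rfl, _, hJ, rfl,
          a + ci + ci, (Action.mem_occ_wait hbb).2 ⟨rfl, by linarith, ?_⟩, le_rfl, by linarith⟩⟩
        exact (WithTop.coe_le_coe.2 (by linarith)).trans (not_lt.1 hlong)

/-- The relevant ends are times of actions plus travel times. A wait window for `j` ends at `a + ci
+ ci + cj`, so subtracting the travel time of `j` stays in the monoid. -/
theorem generateConstraints_endsInTimeMonoid {m : Method}
    (hm : m = .multi → P.EqualTravelTimes) {c : Conflict I V} {π : JointPlan I V}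
    (hπ : ∀ i, P.IsPath i (π i)) (htimes : ∀ i, ∀ x ∈ π i, x.1 ∈ P.timeMonoid)
    (hI : c.actI ∈ P.actions c.agentI (π c.agentI))
    (hJ : c.actJ ∈ P.actions c.agentJ (π c.agentJ)) :
    (∀ k ∈ (P.generateConstraints m c).1, P.EndsInTimeMonoid c.agentI k) ∧
      ∀ k ∈ (P.generateConstraints m c).2, P.EndsInTimeMonoid c.agentJ k := by
  have htI := time_mem_of_mem_actionsFrom (hπ _) (zero_mem _) (htimes _) hI
  have htJ := time_mem_of_mem_actionsFrom (hπ _) (zero_mem _) (htimes _) hJ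
  obtain ⟨u, hu⟩ := Conflict.adj_actI (hπ _) hI
  cases m with
  | single =>
    cases c with
    | inIn i j v u w a a' b b' =>
      simp only [generateConstraints, singleConstraints, Set.mem_singleton_iff, forall_eq]
      exact ⟨htJ.2 _ rfl, htI.2 _ rfl⟩
    | outIn i j v u w a a' b b' =>
      simp only [generateConstraints, singleConstraints, Set.mem_singleton_iff, forall_eq]
      exact ⟨htJ.2 _ rfl, htI.2 _ rfl⟩
    | waitIn i j v u a a' b b' =>
      simp only [generateConstraints, singleConstraints, Set.mem_singleton_iff, forall_eq]
      have : min a' (b'.untopD a') ∈ P.timeMonoid := by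
        have h := htI.2 _ rfl
        induction b' using WithTop.recTopCoe with
        | top => simpa using h
        | coe b' =>
          rcases min_choice a' b' with h' | h' <;> simp only [WithTop.untopD_coe, h']
          · exact h
          · exact htJ.2 _ rfl
      exact ⟨this, this⟩
  | multi =>
    obtain ⟨ci, hci⟩ := hm rfl c.agentI
    obtain ⟨cj, hcj⟩ := hm rfl c.agentJ
    have hi : ci ∈ P.timeMonoid := hci _ _ hu ▸ travelTime_mem hu
    have hj : cj ∈ P.timeMonoid := hcj _ _ hu ▸ travelTime_mem hu
    have hin_i := τin_eq hci hu
    have hin_j := τin_eq hcj hu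
    have hout_i := τout_eq hci hu
    have hout_j := τout_eq hcj hu
    cases c with
    | inIn i j v u w a a' b b' =>
      simp only [Conflict.agentI, Conflict.agentJ, Conflict.vertex] at *
      simp only [generateConstraints, multiConstraints, Set.mem_singleton_iff, forall_eq, hin_i, hin_j, hout_i, hout_j]
      exact ⟨add_mem (add_mem htJ.1 hj) hj, add_mem (add_mem htI.1 hi) hi⟩
    | outIn i j v u w a a' b b' =>
      simp only [Conflict.agentI, Conflict.agentJ, Conflict.vertex] at *
      simp only [generateConstraints, multiConstraints, Set.mem_singleton_iff, Set.mem_insert_iff, forall_eq_or_imp, forall_eq,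
        hin_i, hin_j, hout_i, hout_j]
      refine ⟨add_mem htJ.1 hj, fun x hx => ?_, add_mem (add_mem (add_mem htI.1 hi) hi) hj⟩
      rw [hcj _ _ hx, add_sub_cancel_right]
      exact add_mem (add_mem htI.1 hi) hi
    | waitIn i j v u a a' b b' =>
      simp only [Conflict.agentI, Conflict.agentJ, Conflict.vertex] at *
      simp only [generateConstraints, multiConstraints, hin_i, hin_j, hout_i, hout_j]
      have hwait : ∀ l, P.EndsInTimeMonoid j (.wait v l (a + ci + ci + cj)) := by
        intro l x hx
        rw [hcj _ _ hx, add_sub_cancel_right]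
        exact add_mem (add_mem htI.1 hi) hi
      split_ifs with hlong
      all_goals simp only [Set.mem_singleton_iff, forall_eq]
      · induction b' using WithTop.recTopCoe with
        | top => exact absurd hlong (by simp)
        | coe b' => exact ⟨add_mem (htJ.2 _ rfl) hj, hwait _⟩
      · exact ⟨add_mem (add_mem (add_mem htI.1 hi) hi) hj, hwait _⟩

end MAPFAA

namespace MAPFAA

variable {I V : Type*} {P : MAPFAA I V} {i : I}

/-! ## Existence of an earliest conflict -/

theorem exists_conflict_of_move_into {π : JointPlan I V} (hπ : ∀ i, P.IsPath i (π i)) {i j : I}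
    {u v : V} {d e t : ℝ} (hI : Action.move u v d e ∈ P.actions i (π i))
    (ht : t ∈ (Action.move u v d e).occ v) (hj : P.Occupies j (π j) v t) :
    ∃ c : Conflict I V, c.agentI = i ∧ c.agentJ = j ∧ c.actI ∈ P.actions i (π i) ∧
      c.actJ ∈ P.actions j (π j) ∧ t ∈ c.overlap := by
  obtain ⟨A, hA, htA⟩ := hj
  cases A with
  | move x y b b' =>
    obtain ⟨hadj, heq, -, -⟩ := move_mem_actionsFrom (hπ j) hA
    have hlt : b < b' := by linarith [P.τ_pos j x y hadj]
    rcases (Action.mem_occ_move hlt).1 htA with ⟨rfl, -⟩ | ⟨rfl, -⟩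
    · exact ⟨.outIn i j v u y d e b b', rfl, rfl, hI, hA, ht, htA⟩
    · exact ⟨.inIn i j v u x d e b b', rfl, rfl, hI, hA, ht, htA⟩
  | wait x b b' =>
    obtain ⟨rfl, -⟩ := (Action.mem_occ_wait (wait_mem_actionsFrom (hπ j) hA).2.1).1 htA
    exact ⟨.waitIn i j v u d e b b', rfl, rfl, hI, hA, ht, htA⟩

/-- An agent that is not entering `v` waits there or is leaving, and has been there since its
arrival `s`. This traces a common occupancy back to a move into the vertex, which every type of
conflict requires. -/
theorem Occupies.move_into_or_stays {p : Plan V} (hp : P.IsPath i p) {v : V} {t : ℝ}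
    (h : P.Occupies i p v t) :
    (∃ u d e, Action.move u v d e ∈ P.actions i p ∧ t ∈ (Action.move u v d e).occ v) ∨
      ∃ s ≤ t, (∀ t', s ≤ t' → t' ≤ t → P.Occupies i p v t') ∧
        ((v = P.start i ∧ s = 0) ∨
          0 < s ∧ ∃ u d, Action.move u v d s ∈ P.actions i p ∧ s ∈ (Action.move u v d s).occ v) := by
  have harrive : ∀ {s b}, Action.wait v s b ∈ P.actions i p → (v = P.start i ∧ s = 0) ∨
      0 < s ∧ ∃ u d, Action.move u v d s ∈ P.actions i p ∧ s ∈ (Action.move u v d s).occ v := by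
    intro s b hs
    obtain ⟨-, -, -, -, hstart⟩ := wait_mem_actionsFrom hp hs
    refine hstart.imp_right ?_
    rintro ⟨u, d, hm⟩
    obtain ⟨hadj, heq, hd, -⟩ := move_mem_actionsFrom hp hm
    have := P.τ_pos i u v hadj
    exact ⟨by linarith, u, d, hm, (Action.mem_occ_move (by linarith)).2
      (.inr ⟨rfl, by linarith, le_rfl⟩)⟩
  obtain ⟨A, hA, ht⟩ := h
  cases A with
  | move x y b b' =>
    obtain ⟨hadj, heq, -, -⟩ := move_mem_actionsFrom hp hA
    have hlt : b < b' := by linarith [P.τ_pos i x y hadj]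
    rcases (Action.mem_occ_move hlt).1 ht with ⟨rfl, h1, h2⟩ | ⟨rfl, -⟩
    · right
      obtain ⟨⟨s, hs⟩, -⟩ := exists_wait_of_move_mem hA
      have hsb := (wait_mem_actionsFrom hp hs).2.1
      refine ⟨s, (WithTop.coe_le_coe.1 hsb).trans h1, fun t' hst' htt' => ?_, harrive hs⟩
      rcases le_total t' b with h | h
      · exact ⟨_, hs, (Action.mem_occ_wait hsb).2 ⟨rfl, hst', WithTop.coe_le_coe.2 h⟩⟩
      · exact ⟨_, hA, (Action.mem_occ_move hlt).2 (.inl ⟨rfl, h, by linarith⟩)⟩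
    · exact .inl ⟨_, _, _, hA, ht⟩
  | wait x s b =>
    have hsb := (wait_mem_actionsFrom hp hA).2.1
    obtain ⟨rfl, h1, h2⟩ := (Action.mem_occ_wait hsb).1 ht
    exact .inr ⟨s, h1, fun t' hst' htt' => ⟨_, hA, (Action.mem_occ_wait hsb).2
      ⟨rfl, hst', (WithTop.coe_le_coe.2 htt').trans h2⟩⟩, harrive hA⟩

variable (P) in
/-- The conflict is between the agents `i` and `j`, and these perform its two actions. -/
def IsConflictBetween (π : JointPlan I V) (i j : I) (c : Conflict I V) : Prop :=
  ((c.agentI = i ∧ c.agentJ = j) ∨ (c.agentI = j ∧ c.agentJ = i)) ∧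
    c.actI ∈ P.actions c.agentI (π c.agentI) ∧ c.actJ ∈ P.actions c.agentJ (π c.agentJ)

/-- If neither agent is entering at time `t`, go back to the later of the two arrivals: one agent
enters while the other is present. Distinct starts exclude that both have been there since time `0`.
-/
theorem exists_conflict_le {π : JointPlan I V} (hπ : ∀ i, P.IsPath i (π i)) {i j : I}
    (hij : i ≠ j) {v : V} {t : ℝ} (hi : P.Occupies i (π i) v t) (hj : P.Occupies j (π j) v t) :
    ∃ c, P.IsConflictBetween π i j c ∧ ∃ t' ∈ c.overlap, t' ≤ t := by
  have hIJ : ∀ t' ≤ t, ∀ u d e, Action.move u v d e ∈ P.actions i (π i) →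
      t' ∈ (Action.move u v d e).occ v → P.Occupies j (π j) v t' →
      ∃ c, P.IsConflictBetween π i j c ∧ ∃ t' ∈ c.overlap, t' ≤ t := by
    intro t' ht' u d e hm hocc hj
    obtain ⟨c, rfl, rfl, h1, h2, h3⟩ := exists_conflict_of_move_into hπ hm hocc hj
    exact ⟨c, ⟨.inl ⟨rfl, rfl⟩, h1, h2⟩, t', h3, ht'⟩
  have hJI : ∀ t' ≤ t, ∀ u d e, Action.move u v d e ∈ P.actions j (π j) →
      t' ∈ (Action.move u v d e).occ v → P.Occupies i (π i) v t' →
      ∃ c, P.IsConflictBetween π i j c ∧ ∃ t' ∈ c.overlap, t' ≤ t := by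
    intro t' ht' u d e hm hocc hi
    obtain ⟨c, rfl, rfl, h1, h2, h3⟩ := exists_conflict_of_move_into hπ hm hocc hi
    exact ⟨c, ⟨.inr ⟨rfl, rfl⟩, h1, h2⟩, t', h3, ht'⟩
  rcases Occupies.move_into_or_stays (hπ i) hi with ⟨u, d, e, hm, hocc⟩ | ⟨s, hst, hs, hs'⟩
  · exact hIJ t le_rfl u d e hm hocc hj
  rcases Occupies.move_into_or_stays (hπ j) hj with ⟨u, d, e, hm, hocc⟩ | ⟨r, hrt, hr, hr'⟩
  · exact hJI t le_rfl u d e hm hocc hi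
  rcases hs' with ⟨hv, rfl⟩ | ⟨hs0, u, d, hm, hocc⟩ <;>
    rcases hr' with ⟨hv', rfl⟩ | ⟨hr0, u', d', hm', hocc'⟩
  · exact absurd (P.start_injective (hv.symm.trans hv')) hij
  · exact hJI r hrt u' d' r hm' hocc' (hs r hr0.le hrt)
  · exact hIJ s hst u d s hm hocc (hr s hs0.le hst)
  · rcases le_total r s with h | h
    · exact hIJ s hst u d s hm hocc (hr s h hst)
    · exact hJI r hrt u' d' r hm' hocc' (hs r h hrt)

theorem Conflict.bddBelow_overlap {c : Conflict I V} {p : Plan V} (hp : P.IsPath c.agentI p)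
    (h : c.actI ∈ P.actions c.agentI p) : BddBelow c.overlap := by
  refine ⟨c.actI.startTime, fun t ht => ?_⟩
  have hmove : ∀ u w d e, c.actI = .move u w d e → c.actI.startTime ≤ t := by
    intro u w d e hc
    obtain ⟨hadj, heq, -, -⟩ := move_mem_actionsFrom hp (hc ▸ h)
    have hlt : d < e := by linarith [P.τ_pos c.agentI u w hadj]
    have := ht.1
    rw [hc] at this ⊢
    rcases (Action.mem_occ_move hlt).1 this with h | h
    · exact h.2.1
    · exact h.2.1.le
  cases c <;> exact hmove _ _ _ _ rfl

/-- The overlap depends only on the pair of actions, so two paths give finitely many beginnings of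
overlaps and an earliest one exists. -/
theorem Conflict.overlap_eq (c : Conflict I V) :
    c.overlap = c.actI.occ c.actI.tgt ∩ c.actJ.occ c.actI.tgt := by
  cases c <;> rfl

theorem exists_isEarliestConflict {π : JointPlan I V} (hπ : ∀ i, P.IsPath i (π i))
    (h : ¬ P.ConflictFree π) : ∃ c, P.IsEarliestConflict π c := by
  simp only [ConflictFree, not_forall, not_not] at h
  obtain ⟨i, j, hij, v, t, hi, hj⟩ := h
  let S : Set (Conflict I V) := {c | P.IsConflictBetween π i j c ∧ c.overlap.Nonempty}
  let f : Conflict I V → ℝ := fun c => sInf c.overlap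
  let g : Action V → Action V → ℝ := fun A B => sInf (A.occ A.tgt ∩ B.occ A.tgt)
  have hfin : (f '' S).Finite := by
    refine ((Set.Finite.image2 g (List.finite_toSet (P.actions i (π i)))
      (List.finite_toSet (P.actions j (π j)))).union
      (Set.Finite.image2 g (List.finite_toSet (P.actions j (π j)))
      (List.finite_toSet (P.actions i (π i))))).subset ?_
    rintro _ ⟨c, ⟨⟨hc, hI, hJ⟩, -⟩, rfl⟩
    rcases hc with ⟨rfl, rfl⟩ | ⟨rfl, rfl⟩
    · exact .inl ⟨_, hI, _, hJ, by simp only [f, g, c.overlap_eq]⟩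
    · exact .inr ⟨_, hI, _, hJ, by simp only [f, g, c.overlap_eq]⟩
  have hle : ∀ v t, P.Occupies i (π i) v t → P.Occupies j (π j) v t → ∃ c ∈ S, f c ≤ t := by
    intro v t hi hj
    obtain ⟨c, hc, t', ht', hle⟩ := exists_conflict_le hπ hij hi hj
    exact ⟨c, ⟨hc, t', ht'⟩, (csInf_le (Conflict.bddBelow_overlap (hπ _) hc.2.1) ht').trans hle⟩
  obtain ⟨c₀, hc₀, -⟩ := hle v t hi hj
  obtain ⟨_, ⟨c, hc, rfl⟩, hmin⟩ := Set.exists_min_image _ id hfin ⟨_, c₀, hc₀, rfl⟩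
  have hearliest : ∀ v t, P.Occupies i (π i) v t → P.Occupies j (π j) v t → f c ≤ t := by
    intro v t hi hj
    obtain ⟨c', hc', hle⟩ := hle v t hi hj
    exact (hmin _ ⟨c', hc', rfl⟩).trans hle
  obtain ⟨⟨hc, hI, hJ⟩, hne⟩ := hc
  rcases hc with ⟨rfl, rfl⟩ | ⟨rfl, rfl⟩
  · exact ⟨c, hij, hI, hJ, hne, hearliest⟩
  · exact ⟨c, hij.symm, hI, hJ, hne, fun v t h1 h2 => hearliest v t h2 h1⟩

/-! ## Nodes of the search -/

variable (P)

/-- The invariant of the nodes: every agent has an optimal path for its constraints, and all ends of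
constraints are sums of travel times. -/
structure ValidNode (N : Node I V) : Prop where
  ends : ∀ k, ∀ c ∈ constraintsOf N.constraints k, P.EndsInTimeMonoid k c
  planned : ∀ k, ∃ soft : V → Set ℝ, (∀ w, ∀ b ∈ soft w, b ∈ P.timeMonoid) ∧
    P.LowLevelPlan k (constraintsOf N.constraints k) soft (N.plan k)

/-- No action of the joint plan is forbidden by a constraint on its agent. -/
def Respects (σ : JointPlan I V) (Ω : Set (I × Constraint V)) : Prop :=
  ∀ k, ∀ A ∈ P.actions k (σ k), Allowed (constraintsOf Ω k) A

variable {P}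

theorem ValidNode.isPath {N : Node I V} (h : P.ValidNode N) (k : I) : P.IsPath k (N.plan k) := by
  obtain ⟨soft, -, hl⟩ := h.planned k
  exact GeneratedFrom.isPathFrom hl.1

theorem ValidNode.respects {N : Node I V} (h : P.ValidNode N) :
    P.Respects N.plan N.constraints := by
  intro k A hA
  obtain ⟨soft, -, hl⟩ := h.planned k
  exact GeneratedFrom.allowed hl.1 hA

theorem constraintsOf_union_of_ne {Ω : Set (I × Constraint V)} {ω : Set (Constraint V)} {j k : I}
    (h : j ≠ k) : constraintsOf (Ω ∪ {x | x.1 = k ∧ x.2 ∈ ω}) j = constraintsOf Ω j := by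
  ext c
  simp [constraintsOf, h]

theorem mem_constraintsOf_union {Ω : Set (I × Constraint V)} {ω : Set (Constraint V)} {k : I}
    {c : Constraint V} : c ∈ constraintsOf (Ω ∪ {x | x.1 = k ∧ x.2 ∈ ω}) k ↔
      c ∈ constraintsOf Ω k ∨ c ∈ ω := by
  simp [constraintsOf]

theorem ValidNode.ends_union {N : Node I V} (h : P.ValidNode N) {k : I} {ω : Set (Constraint V)}
    (hω : ∀ c ∈ ω, P.EndsInTimeMonoid k c) (j : I) :
    ∀ c ∈ constraintsOf (N.constraints ∪ {x | x.1 = k ∧ x.2 ∈ ω}) j, P.EndsInTimeMonoid j c := by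
  intro c hc
  by_cases hjk : j = k
  · subst hjk
    exact (mem_constraintsOf_union.1 hc).elim (h.ends j c) (hω c)
  · rw [constraintsOf_union_of_ne hjk] at hc
    exact h.ends j c hc

variable (P) in
/-- The tagged constraints with which a conflict is resolved, for either of its two agents. -/
noncomputable def resolution (m : Method) : Conflict I V × Bool → Set (I × Constraint V)
  | (c, true) => {x | x.1 = c.agentI ∧ x.2 ∈ (P.generateConstraints m c).1}
  | (c, false) => {x | x.1 = c.agentJ ∧ x.2 ∈ (P.generateConstraints m c).2}

theorem ValidNode.not_resolution_subset {m : Method} (hm : m = .multi → P.EqualTravelTimes) {N : Node I V}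
    (h : P.ValidNode N) {c : Conflict I V} (hc : P.IsEarliestConflict N.plan c) (b : Bool) :
    ¬ P.resolution m (c, b) ⊆ N.constraints := by
  intro hsub
  obtain ⟨⟨k, hk, A, hA, hkA⟩, k', hk', A', hA', hkA'⟩ := hc.exists_forbidden hm h.isPath
  cases b with
  | true => exact h.respects _ A hA k (hsub ⟨rfl, hk⟩) hkA
  | false => exact h.respects _ A' hA' k' (hsub ⟨rfl, hk'⟩) hkA'

section Finite

variable [Finite I] [Finite V]

theorem ValidNode.times {N : Node I V} (h : P.ValidNode N) (k : I) :
    ∀ x ∈ N.plan k, x.1 ∈ P.timeMonoid := by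
  obtain ⟨soft, hsoft, hl⟩ := h.planned k
  exact GeneratedFrom.mem_timeMonoid (h.ends k) hsoft (zero_mem _) hl.1

theorem ValidNode.cost_le {N : Node I V} (h : P.ValidNode N) {σ : JointPlan I V}
    (hσ : ∀ i, P.IsPath i (σ i)) (hr : P.Respects σ N.constraints) (k : I) :
    P.cost k (N.plan k) ≤ P.cost k (σ k) := by
  obtain ⟨soft, -, hl⟩ := h.planned k
  obtain ⟨q, hq, hle⟩ := exists_generated_le (h.ends k) soft (hσ k) (hr k)
  exact (hl.2 q hq).trans hle

theorem ValidNode.softEnds_mem {N : Node I V} (h : P.ValidNode N) (k : I) (w : V) :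
    ∀ b ∈ P.softEnds N.plan k w, b ∈ P.timeMonoid := by
  rintro b ⟨j, -, x, a, hA⟩
  exact (time_mem_of_mem_actionsFrom (h.isPath j) (zero_mem _) (h.times j) hA).2 b rfl

theorem Child.validNode {N : Node I V} (h : P.ValidNode N) {k : I} {ω : Set (Constraint V)}
    (hω : ∀ c ∈ ω, P.EndsInTimeMonoid k c) {S : Multiset (Node I V)} (hS : P.Child N k ω S) :
    ∀ N' ∈ S, P.ValidNode N' := by
  cases hS with
  | infeasible hnone => simp
  | planned N' hc hother hplan =>
    simp only [Multiset.mem_singleton, forall_eq]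
    refine ⟨hc ▸ h.ends_union hω, fun j => ?_⟩
    by_cases hjk : j = k
    · subst hjk
      exact ⟨_, h.softEnds_mem j, hplan⟩
    · rw [hc, constraintsOf_union_of_ne hjk, hother j hjk]
      exact h.planned j

/-- The planner cannot fail here, since the path of `σ` obeys the enlarged constraints and is
dominated by a generated path. -/
theorem Child.exists_respects {N : Node I V} (h : P.ValidNode N) {k : I} {ω : Set (Constraint V)}
    (hω : ∀ c ∈ ω, P.EndsInTimeMonoid k c) {S : Multiset (Node I V)} (hS : P.Child N k ω S)
    {σ : JointPlan I V} (hσ : ∀ i, P.IsPath i (σ i)) (hr : P.Respects σ N.constraints)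
    (hr' : ∀ A ∈ P.actions k (σ k), Allowed ω A) :
    ∃ N' ∈ S, P.Respects σ N'.constraints := by
  have hall : P.Respects σ (N.constraints ∪ {x | x.1 = k ∧ x.2 ∈ ω}) := by
    intro j A hA
    by_cases hjk : j = k
    · subst hjk
      exact fun c hc => (mem_constraintsOf_union.1 hc).elim (hr j A hA c) (hr' A hA c)
    · rw [constraintsOf_union_of_ne hjk]
      exact hr j A hA
  cases hS with
  | infeasible hnone =>
    obtain ⟨q, hq, -⟩ := exists_generated_le (h.ends_union hω k) (P.softEnds N.plan k) (hσ k)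
      (hall k)
    exact absurd hq (hnone q)
  | planned N' hc hother hplan =>
    exact ⟨N', Multiset.mem_singleton_self _, hc ▸ hall⟩

theorem ValidNode.exists_child {N : Node I V} (h : P.ValidNode N) {k : I} {ω : Set (Constraint V)}
    (hω : ∀ c ∈ ω, P.EndsInTimeMonoid k c) : ∃ S, P.Child N k ω S := by
  classical
  by_cases hex : ∃ p, P.Generated k
      (constraintsOf (N.constraints ∪ {x | x.1 = k ∧ x.2 ∈ ω}) k) (P.softEnds N.plan k) p
  · obtain ⟨p, hp⟩ := exists_lowLevelPlan (h.ends_union hω k) (h.softEnds_mem k) hex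
    exact ⟨_, .planned ⟨Function.update N.plan k p, _⟩ rfl
      (fun j hj => Function.update_of_ne hj _ _) (by simpa using hp)⟩
  · exact ⟨0, .infeasible (not_exists.1 hex)⟩

end Finite

/-! ## The invariant of the search -/

variable [Fintype I]

theorem cost_le_sumOfCosts {π : JointPlan I V} (hπ : ∀ i, P.IsPath i (π i)) (i : I) :
    P.cost i (π i) ≤ P.sumOfCosts π :=
  Finset.single_le_sum (f := fun i => P.cost i (π i)) (fun j _ => le_arrivalFrom (hπ j))
    (Finset.mem_univ i)

variable (P) in
/-- Every solution is still represented in OPEN, and what is reported is correct. -/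
def SearchInvariant : SearchState I V → Prop
  | .running OPEN => (∀ N ∈ OPEN, P.ValidNode N) ∧
      ∀ σ, P.IsSolution σ → ∃ N ∈ OPEN, P.Respects σ N.constraints
  | .returned π => P.IsOptimal π
  | .failure => ∀ σ, ¬ P.IsSolution σ

theorem Initial.searchInvariant {s : SearchState I V} (h : P.Initial s) : P.SearchInvariant s := by
  obtain ⟨π, hπ, rfl⟩ := h
  simp only [SearchInvariant, Multiset.mem_singleton, forall_eq, exists_eq_left]
  refine ⟨⟨fun k c hc => absurd hc (Set.notMem_empty _), fun k => ⟨_, ?_, hπ k⟩⟩,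
    fun σ _ k A _ c hc => absurd hc (Set.notMem_empty _)⟩
  simp

variable [Finite V]

theorem ValidNode.sumOfCosts_le {N : Node I V} (h : P.ValidNode N) {σ : JointPlan I V}
    (hσ : ∀ i, P.IsPath i (σ i)) (hr : P.Respects σ N.constraints) :
    P.sumOfCosts N.plan ≤ P.sumOfCosts σ :=
  Finset.sum_le_sum fun k _ => h.cost_le hσ hr k

theorem exists_initial {σ : JointPlan I V} (hσ : P.IsSolution σ) : ∃ s, P.Initial s := by
  have : ∀ i, ∃ p, P.LowLevelPlan i ∅ (fun _ => ∅) p := by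
    intro i
    have hC : ∀ c ∈ (∅ : Set (Constraint V)), P.EndsInTimeMonoid i c := by simp
    obtain ⟨q, hq, -⟩ := exists_generated_le hC (fun _ => ∅) (hσ.1 i)
      (fun A _ c hc => absurd hc (Set.notMem_empty _))
    exact exists_lowLevelPlan hC (by simp) ⟨q, hq⟩
  choose π hπ using this
  exact ⟨_, π, hπ, rfl⟩

/-- Some node in OPEN has constraints that `σ` obeys; it costs at most `σ`, and the removed node
costs at most as much. -/
theorem sumOfCosts_le_of_minimal {N : Node I V} {R : Multiset (Node I V)}
    (hmin : ∀ M ∈ R, P.sumOfCosts N.plan ≤ P.sumOfCosts M.plan)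
    (h : P.SearchInvariant (.running (N ::ₘ R))) {σ : JointPlan I V} (hσ : P.IsSolution σ) :
    P.sumOfCosts N.plan ≤ P.sumOfCosts σ := by
  obtain ⟨M, hM, hr⟩ := h.2 σ hσ
  have hle := (h.1 M hM).sumOfCosts_le hσ.1 hr
  rcases Multiset.mem_cons.1 hM with rfl | hM
  · exact hle
  · exact (hmin M hM).trans hle

variable {m : Method}

theorem Step.searchInvariant (hm : m = .multi → P.EqualTravelTimes) {s s' : SearchState I V}
    (h : P.SearchInvariant s) (hs : P.Step m s s') : P.SearchInvariant s' := by
  cases hs with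
  | finish N R hmin hfree =>
    exact ⟨⟨(h.1 N (Multiset.mem_cons_self ..)).isPath, hfree⟩,
      fun σ hσ => sumOfCosts_le_of_minimal hmin h hσ⟩
  | fail =>
    intro σ hσ
    obtain ⟨N, hN, -⟩ := h.2 σ hσ
    exact absurd hN (Multiset.notMem_zero _)
  | expand N R hmin c hc S T hS hT =>
    have hN := h.1 N (Multiset.mem_cons_self ..)
    obtain ⟨hωI, hωJ⟩ := generateConstraints_endsInTimeMonoid hm hN.isPath hN.times hc.2.1 hc.2.2.1
    refine ⟨fun M hM => ?_, fun σ hσ => ?_⟩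
    · rcases Multiset.mem_add.1 hM with hM | hM
      · rcases Multiset.mem_add.1 hM with hM | hM
        · exact h.1 M (Multiset.mem_cons_of_mem hM)
        · exact hS.validNode hN hωI M hM
      · exact hT.validNode hN hωJ M hM
    · obtain ⟨M, hM, hr⟩ := h.2 σ hσ
      rcases Multiset.mem_cons.1 hM with rfl | hM
      -- If `σ` violates the new constraints of the first agent, disjointness makes it obey those of
      -- the second.
      · by_cases hI : ∀ A ∈ P.actions c.agentI (σ c.agentI),
          Allowed (P.generateConstraints m c).1 A
        · obtain ⟨M', hM', hr'⟩ := hS.exists_respects hN hωI hσ.1 hr hI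
          exact ⟨M', by simp [hM'], hr'⟩
        · obtain ⟨M', hM', hr'⟩ := hT.exists_respects hN hωJ hσ.1 hr (by
            intro B hB k' hk' hkB
            simp only [Allowed, not_forall, not_not] at hI
            obtain ⟨A, hA, k, hk, hkA⟩ := hI
            exact generateConstraints_disjoint hm hN.isPath hc.2.1 hc.2.2.1 hc.1 hσ hA hB hk hk'
              hkA hkB)
          exact ⟨M', by simp [hM'], hr'⟩
      · exact ⟨M, by simp [hM], hr⟩

theorem Reaches.searchInvariant (hm : m = .multi → P.EqualTravelTimes) {s₀ s : SearchState I V}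
    (h₀ : P.Initial s₀) (h : P.Reaches m s₀ s) : P.SearchInvariant s := by
  induction h with
  | refl => exact h₀.searchInvariant
  | tail _ hs ih => exact hs.searchInvariant hm ih

theorem exists_step_of_running (hm : m = .multi → P.EqualTravelTimes)
    {OPEN : Multiset (Node I V)} (h : P.SearchInvariant (.running OPEN)) :
    ∃ s, P.Step m (.running OPEN) s := by
  rcases OPEN.empty_or_exists_mem with rfl | ⟨N₀, hN₀⟩
  · exact ⟨_, .fail⟩
  · classical
    obtain ⟨N, hN, hmin⟩ := Finset.exists_min_image OPEN.toFinset (fun N => P.sumOfCosts N.plan)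
      ⟨N₀, by simpa using hN₀⟩
    rw [Multiset.mem_toFinset] at hN
    simp only [Multiset.mem_toFinset] at hmin
    obtain ⟨R, rfl⟩ := Multiset.exists_cons_of_mem hN
    have hmin' : ∀ M ∈ R, P.sumOfCosts N.plan ≤ P.sumOfCosts M.plan := fun M hM =>
      hmin M (Multiset.mem_cons_of_mem hM)
    by_cases hfree : P.ConflictFree N.plan
    · exact ⟨_, .finish N R hmin' hfree⟩
    · have hN := h.1 N (Multiset.mem_cons_self ..)
      obtain ⟨c, hc⟩ := exists_isEarliestConflict hN.isPath hfree
      obtain ⟨hωI, hωJ⟩ := generateConstraints_endsInTimeMonoid hm hN.isPath hN.times hc.2.1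
        hc.2.2.1
      obtain ⟨S, hS⟩ := hN.exists_child hωI
      obtain ⟨T, hT⟩ := hN.exists_child hωJ
      exact ⟨_, .expand N R hmin' c hc S T hS hT⟩

/-! ## Termination -/

variable (P) in
/-- The conflicts in joint paths that depart at sums of travel times and have sum of costs at most
`B`. -/
def boundedConflicts (B : ℝ) : Set (Conflict I V) :=
  {c | ∃ π : JointPlan I V, (∀ i, P.IsPath i (π i)) ∧ (∀ i, ∀ x ∈ π i, x.1 ∈ P.timeMonoid) ∧
    P.sumOfCosts π ≤ B ∧ c.actI ∈ P.actions c.agentI (π c.agentI) ∧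
    c.actJ ∈ P.actions c.agentJ (π c.agentJ)}

variable (P) in
theorem finite_boundedConflicts (B : ℝ) : (P.boundedConflicts B).Finite := by
  have hfin := P.finite_timeMonoid_le B
  let T := {x | x ∈ P.timeMonoid ∧ x ≤ B}
  let T' : Set (WithTop ℝ) := (fun x : ℝ => (x : WithTop ℝ)) '' T ∪ {⊤}
  have : Finite T := hfin.to_subtype
  have : Finite T' := ((hfin.image _).union (Set.finite_singleton ⊤)).to_subtype
  refine (((Set.finite_range fun x : I × I × V × V × V × T × T × T × T =>
      Conflict.inIn x.1 x.2.1 x.2.2.1 x.2.2.2.1 x.2.2.2.2.1 x.2.2.2.2.2.1.1 x.2.2.2.2.2.2.1.1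
        x.2.2.2.2.2.2.2.1.1 x.2.2.2.2.2.2.2.2.1).union
    (Set.finite_range fun x : I × I × V × V × V × T × T × T × T =>
      Conflict.outIn x.1 x.2.1 x.2.2.1 x.2.2.2.1 x.2.2.2.2.1 x.2.2.2.2.2.1.1 x.2.2.2.2.2.2.1.1
        x.2.2.2.2.2.2.2.1.1 x.2.2.2.2.2.2.2.2.1)).union
    (Set.finite_range fun x : I × I × V × V × T × T × T × T' =>
      Conflict.waitIn x.1 x.2.1 x.2.2.1 x.2.2.2.1 x.2.2.2.2.1.1 x.2.2.2.2.2.1.1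
        x.2.2.2.2.2.2.1.1 x.2.2.2.2.2.2.2.1)).subset ?_
  rintro c ⟨π, hπ, htimes, hB, hI, hJ⟩
  have hmove : ∀ i u w d e, Action.move u w d e ∈ P.actions i (π i) → d ∈ T ∧ e ∈ T := by
    intro i u w d e hA
    obtain ⟨hadj, heq, -, hle⟩ := move_mem_actionsFrom (hπ i) hA
    have h1 := P.τ_pos i u w hadj
    have h2 : e ≤ B := (hle.trans (cost_le_sumOfCosts hπ i)).trans hB
    obtain ⟨h3, h4⟩ := time_mem_of_mem_actionsFrom (hπ i) (zero_mem _) (htimes i) hA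
    exact ⟨⟨h3, (show d ≤ B by linarith)⟩, h4 e rfl, h2⟩
  cases c with
  | inIn i j v u w a a' b b' =>
    obtain ⟨ha, ha'⟩ := hmove _ _ _ _ _ hI
    obtain ⟨hb, hb'⟩ := hmove _ _ _ _ _ hJ
    exact .inl (.inl ⟨(i, j, v, u, w, ⟨a, ha⟩, ⟨a', ha'⟩, ⟨b, hb⟩, ⟨b', hb'⟩), rfl⟩)
  | outIn i j v u w a a' b b' =>
    obtain ⟨ha, ha'⟩ := hmove _ _ _ _ _ hI
    obtain ⟨hb, hb'⟩ := hmove _ _ _ _ _ hJ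
    exact .inl (.inr ⟨(i, j, v, u, w, ⟨a, ha⟩, ⟨a', ha'⟩, ⟨b, hb⟩, ⟨b', hb'⟩), rfl⟩)
  | waitIn i j v u a a' b b' =>
    obtain ⟨ha, ha'⟩ := hmove _ _ _ _ _ hI
    obtain ⟨-, -, hle, hend, -⟩ := wait_mem_actionsFrom (hπ _) hJ
    have hb : b ∈ T := ⟨(time_mem_of_mem_actionsFrom (hπ _) (zero_mem _) (htimes _) hJ).1,
      (hle.trans (cost_le_sumOfCosts hπ j)).trans hB⟩
    have hb' : b' ∈ T' := by
      rcases hend with rfl | ⟨d, w, rfl, hm⟩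
      · exact .inr rfl
      · exact .inl ⟨d, (hmove _ _ _ _ _ hm).1, rfl⟩
    exact .inr ⟨(i, j, v, u, ⟨a, ha⟩, ⟨a', ha'⟩, ⟨b, hb⟩, ⟨b', hb'⟩), rfl⟩

variable (P) in
/-- The ways of resolving a bounded conflict that have not been applied to the node. -/
def unresolved (m : Method) (B : ℝ) (N : Node I V) : Set (Conflict I V × Bool) :=
  {x | x.1 ∈ P.boundedConflicts B ∧ ¬ P.resolution m x ⊆ N.constraints}

theorem ncard_unresolved_lt {B : ℝ} {N N' : Node I V} {x : Conflict I V × Bool}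
    (hx : x.1 ∈ P.boundedConflicts B) (hn : ¬ P.resolution m x ⊆ N.constraints)
    (hc : N'.constraints = N.constraints ∪ P.resolution m x) :
    (P.unresolved m B N').ncard < (P.unresolved m B N).ncard := by
  refine Set.ncard_lt_ncard ⟨fun y hy => ⟨hy.1, fun h => hy.2 ?_⟩, fun h => (h ⟨hx, hn⟩).2 ?_⟩ ?_
  · exact hc ▸ h.trans Set.subset_union_left
  · exact hc ▸ Set.subset_union_right
  · exact ((P.finite_boundedConflicts B).prod (Set.toFinite (Set.univ : Set Bool))).subset
      fun y hy => ⟨hy.1, trivial⟩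

variable (P) in
/-- The weight of a node exceeds the total weight of its children. -/
noncomputable def nodeWeight (m : Method) (B : ℝ) (N : Node I V) : ℕ :=
  3 ^ (P.unresolved m B N).ncard

variable (P) in
/-- The total weight of the nodes in OPEN. -/
noncomputable def searchWeight (m : Method) (B : ℝ) : SearchState I V → ℕ
  | .running OPEN => (OPEN.map (P.nodeWeight m B)).sum
  | _ => 0

/-- The new resolution is no longer unresolved in the child, which costs a factor `3`. Two children
thus weigh at most two thirds of their parent; base `2` would not give a strict decrease. -/
theorem Child.three_mul_weight_le {B : ℝ} {N : Node I V} {k : I} {ω : Set (Constraint V)}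
    {S : Multiset (Node I V)} (hS : P.Child N k ω S) {x : Conflict I V × Bool}
    (hω : P.resolution m x = {y | y.1 = k ∧ y.2 ∈ ω}) (hx : x.1 ∈ P.boundedConflicts B)
    (hn : ¬ P.resolution m x ⊆ N.constraints) :
    3 * (S.map (P.nodeWeight m B)).sum ≤ P.nodeWeight m B N := by
  cases hS with
  | infeasible hnone => simp
  | planned N' hc hother hplan =>
    have h := ncard_unresolved_lt hx hn (hω ▸ hc)
    simp only [Multiset.map_singleton, Multiset.sum_singleton, nodeWeight]
    rw [← pow_succ']
    exact Nat.pow_le_pow_right (by norm_num) h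

theorem Step.searchWeight_lt (hm : m = .multi → P.EqualTravelTimes) {σ : JointPlan I V}
    (hσ : P.IsSolution σ) {O O' : Multiset (Node I V)} (h : P.SearchInvariant (.running O))
    (hs : P.Step m (.running O) (.running O')) :
    P.searchWeight m (P.sumOfCosts σ) (.running O') <
      P.searchWeight m (P.sumOfCosts σ) (.running O) := by
  cases hs with
  | expand N R hmin c hc S T hS hT =>
    have hN := h.1 N (Multiset.mem_cons_self ..)
    have hmem : c ∈ P.boundedConflicts (P.sumOfCosts σ) :=
      ⟨N.plan, hN.isPath, hN.times, sumOfCosts_le_of_minimal hmin h hσ, hc.2.1, hc.2.2.1⟩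
    have h1 := hS.three_mul_weight_le (x := (c, true)) rfl hmem (hN.not_resolution_subset hm hc _)
    have h2 := hT.three_mul_weight_le (x := (c, false)) rfl hmem (hN.not_resolution_subset hm hc _)
    have h3 : 0 < P.nodeWeight m (P.sumOfCosts σ) N := Nat.pow_pos (by norm_num)
    simp only [searchWeight, Multiset.map_add, Multiset.sum_add, Multiset.map_cons,
      Multiset.sum_cons]
    omega

theorem terminates_of_isSolution (hm : m = .multi → P.EqualTravelTimes) {σ : JointPlan I V}
    (hσ : P.IsSolution σ) {s₀ : SearchState I V} (h₀ : P.Initial s₀) : P.Terminates m s₀ := by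
  rintro ⟨run, rfl, hrun⟩
  have hinv : ∀ n, P.SearchInvariant (run n) := by
    intro n
    induction n with
    | zero => exact h₀.searchInvariant
    | succ n ih => exact (hrun n).searchInvariant hm ih
  -- Only running states have a successor.
  have hrunning : ∀ n, ∃ O, run n = .running O := by
    intro n
    have h := hrun n
    generalize run n = s, run (n + 1) = s' at h
    cases h <;> exact ⟨_, rfl⟩
  refine not_strictAnti_of_wellFoundedLT
    (fun n => P.searchWeight m (P.sumOfCosts σ) (run n)) (strictAnti_nat_of_succ_lt fun n => ?_)
  obtain ⟨O, hO⟩ := hrunning n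
  obtain ⟨O', hO'⟩ := hrunning (n + 1)
  have h1 := hrun n
  have h2 := hinv n
  rw [hO] at h1 h2
  rw [hO'] at h1
  simp only [hO, hO']
  exact h1.searchWeight_lt hm hσ h2

end MAPFAA

/-! ### The main theorem -/

theorem mainTheorem1 {I V : Type*} [Fintype I] [Finite V] (P : MAPFAA I V) (m : MAPFAA.Method)
    (hm : m = MAPFAA.Method.multi → P.EqualTravelTimes) :
    (∀ s₀ π, P.Initial s₀ → P.Reaches m s₀ (MAPFAA.SearchState.returned π) → P.IsOptimal π) ∧
    ((∃ σ, P.IsSolution σ) →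
      (∃ s₀, P.Initial s₀) ∧
      ∀ s₀, P.Initial s₀ →
        P.Terminates m s₀ ∧
        ∀ s, P.Reaches m s₀ s → (∀ s', ¬ P.Step m s s') →
          ∃ π, s = MAPFAA.SearchState.returned π ∧ P.IsOptimal π) := by
  refine ⟨fun s₀ π h₀ h => MAPFAA.Reaches.searchInvariant hm h₀ h, ?_⟩
  rintro ⟨σ, hσ⟩
  refine ⟨MAPFAA.exists_initial hσ, fun s₀ h₀ =>
    ⟨MAPFAA.terminates_of_isSolution hm hσ h₀, fun s h hstuck => ?_⟩⟩
  have hinv := MAPFAA.Reaches.searchInvariant hm h₀ h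
  match s, hinv with
  | .running O, hinv =>
    obtain ⟨s', hs'⟩ := MAPFAA.exists_step_of_running hm hinv
    exact absurd hs' (hstuck s')
  | .returned π, hinv => exact ⟨π, rfl, hinv⟩
  | .failure, hinv => exact absurd hσ (hinv σ)
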